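/- In the zero forcing process on a finite graph $G$, the vertices are initially coloured black or white, and repeatedly, whenever a black vertex has exactly one white neighbour, that neighbour becomes black. A set $W$ of vertices is a zero blocking set if, starting with exactly the vertices of $W$ white, some vertex stays white for ever; the zero blocking number $B(G)$ is the minimum size of a zero blocking set. For the grid graph $G_{m,n}=P_m\Box P_n$, the Cartesian product of the paths on $m$ and $n$ vertices, with $n\ge m\ge 2$, let $q$ and $r$ be the integers with $n-m=q(m+1)-r$ and $0\le r\le m$. Then $B(G_{m,n})=n-q+\lceil r/2\rceil$ if $r\le 2q$, and $B(G_{m,n})=n-q+m-1$ if $r>2q$. -/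

import Mathlib

/-- The vertices that are black at the end of the zero forcing process on `G` started with the set
`B` of black vertices: a vertex `v` is forced by a black neighbour `u` if every neighbour of `u`
other than `v` is already black. -/
inductive SimpleGraph.ZeroForced {V : Type*} (G : SimpleGraph V) (B : Set V) : V → Prop
  | init (v : V) (hv : v ∈ B) : SimpleGraph.ZeroForced G B v
  | force (u v : V) (hu : SimpleGraph.ZeroForced G B u) (huv : G.Adj u v)
      (h : ∀ w, G.Adj u w → w ≠ v → SimpleGraph.ZeroForced G B w) : SimpleGraph.ZeroForced G B v

/-- `B` is a zero forcing set: starting from `B`, every vertex ultimately becomes black. -/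
def SimpleGraph.IsZeroForcingSet {V : Type*} (G : SimpleGraph V) (B : Set V) : Prop :=
  ∀ v, G.ZeroForced B v

/-- `W` is a zero blocking set: when exactly the vertices of `W` are initially white, some vertex
stays white for ever. -/
def SimpleGraph.IsZeroBlockingSet {V : Type*} (G : SimpleGraph V) (W : Set V) : Prop :=
  ¬ G.IsZeroForcingSet Wᶜ

/-- The zero blocking number of a finite graph: the minimum size of a zero blocking set. -/
noncomputable def SimpleGraph.zeroBlockingNumber {V : Type*} [Fintype V] (G : SimpleGraph V) : ℕ :=
  sInf {k : ℕ | ∃ W : Finset V, G.IsZeroBlockingSet (W : Set V) ∧ W.card = k}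

/-- On a nonempty graph the minimum defining the zero blocking number is attained. -/
theorem SimpleGraph.isLeast_zeroBlockingNumber {V : Type*} [Fintype V] [Nonempty V]
    (G : SimpleGraph V) :
    IsLeast {k : ℕ | ∃ W : Finset V, G.IsZeroBlockingSet (W : Set V) ∧ W.card = k}
      G.zeroBlockingNumber := by
  refine ⟨Nat.sInf_mem ⟨_, Finset.univ, fun h => ?_, rfl⟩, fun k hk => Nat.sInf_le hk⟩
  have key : ∀ v, ¬ G.ZeroForced ((Finset.univ : Finset V) : Set V)ᶜ v := by
    intro v hv
    induction hv with
    | init v hv => simp at hv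
    | force _ _ _ _ _ ih _ => exact ih
  exact key (Classical.arbitrary V) (h _)

/-- The grid graph, the Cartesian product of the paths with `m` and with `n` vertices. -/
def gridGraph (m n : ℕ) : SimpleGraph (Fin m × Fin n) :=
  SimpleGraph.boxProd (SimpleGraph.pathGraph m) (SimpleGraph.pathGraph n)

/-! A set is zero blocking exactly when it contains a fort, so the task is to find the least number
of cells of a fort `W`.

Lower bound. Every cell of `W` lies in the cone below a cell of `W` in row `1` and in the cone above
one in row `m`. So column `j` of `W` lies between an upper envelope `1 + d j` and a lower envelope
`m - d' j`, where `d` and `d'` are the distances to the columns of the cells in rows `1` and `m`. An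
envelope place is vacant only at a peak of the distance (`isPeak_top`), and peaks are never
adjacent. The quantity to bound is the excess, the number of cells minus the number of columns. A
column whose envelopes meet in a cell of `W` is proper and has one cell; any other column has at
least two cells, less its vacant envelope places. Counting peaks, a stretch between consecutive
proper columns has excess at least `m - 2` (`sum_gap`), unless it is void or a single empty column.
A stretch at an end of the board has excess at least `(m - 1) / 2`, and usually `m - 2`, thanks to
cells off the envelopes near the end column (`sum_left`).

An empty column with at least `m` columns on each side cuts the fort into two forts, and the bound
is superadditive (`SizeBound.add`). Without such a column the excess is nonnegative, which suffices
for `r ≤ 2q`. Moreover, if it is below `m - 2`, the proper columns form an interval reaching an end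
of the board, and `W` zigzags there between rows `1` and `m` (`sum_or_zigzag`). Consecutive turns
are `m - 1` or `m` columns apart, so `k(m - 1) ≤ n - m ≤ km` for some `k`, which is impossible for
`r > 2q`.

Upper bound. For `r ≤ 2q`, a chain of diagonals is used in which consecutive ones share a corner,
have adjacent corners, or are separated by an empty column. For `r > 2q`, a fort made of four
segments is continued by `q - 1` diagonals, each after an empty column. -/

/-! ### Forts of the board, their symmetries and the cone property -/

/-- A fort of the board with rows `1, …, m` and columns `1, …, n`: a nonempty set of cells such that
no cell of the board outside the set has exactly one neighbour in the set. -/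
structure GridFort (m n : ℤ) (W : ℤ → ℤ → Prop) : Prop where
  row_pos : ∀ {i j}, W i j → 1 ≤ i
  row_le : ∀ {i j}, W i j → i ≤ m
  col_pos : ∀ {i j}, W i j → 1 ≤ j
  col_le : ∀ {i j}, W i j → j ≤ n
  nonempty : ∃ i j, W i j
  above : ∀ {i j}, 1 ≤ i → i ≤ m → 1 ≤ j → j ≤ n → ¬ W i j → W (i - 1) j →
    W (i + 1) j ∨ W i (j - 1) ∨ W i (j + 1)
  below : ∀ {i j}, 1 ≤ i → i ≤ m → 1 ≤ j → j ≤ n → ¬ W i j → W (i + 1) j →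
    W (i - 1) j ∨ W i (j - 1) ∨ W i (j + 1)
  left : ∀ {i j}, 1 ≤ i → i ≤ m → 1 ≤ j → j ≤ n → ¬ W i j → W i (j - 1) →
    W (i - 1) j ∨ W (i + 1) j ∨ W i (j + 1)
  right : ∀ {i j}, 1 ≤ i → i ≤ m → 1 ≤ j → j ≤ n → ¬ W i j → W i (j + 1) →
    W (i - 1) j ∨ W (i + 1) j ∨ W i (j - 1)

namespace GridFort

variable {m n : ℤ} {W : ℤ → ℤ → Prop}

theorem transpose (h : GridFort m n W) : GridFort n m (fun i j => W j i) where
  row_pos := h.col_pos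
  row_le := h.col_le
  col_pos := h.row_pos
  col_le := h.row_le
  nonempty := let ⟨i, j, hij⟩ := h.nonempty; ⟨j, i, hij⟩
  above := by
    intro i j h1 h2 h3 h4 h5 h6
    have := h.left h3 h4 h1 h2 h5 h6
    tauto
  below := by
    intro i j h1 h2 h3 h4 h5 h6
    have := h.right h3 h4 h1 h2 h5 h6
    tauto
  left := by
    intro i j h1 h2 h3 h4 h5 h6
    have := h.above h3 h4 h1 h2 h5 h6
    tauto
  right := by
    intro i j h1 h2 h3 h4 h5 h6
    have := h.below h3 h4 h1 h2 h5 h6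
    tauto

theorem flipRows (h : GridFort m n W) : GridFort m n (fun i j => W (m + 1 - i) j) where
  row_pos := fun hij => by have := h.row_le hij; omega
  row_le := fun hij => by have := h.row_pos hij; omega
  col_pos := fun hij => h.col_pos hij
  col_le := fun hij => h.col_le hij
  nonempty := by
    obtain ⟨i, j, hij⟩ := h.nonempty
    exact ⟨m + 1 - i, j, by simpa using hij⟩
  above := by
    intro i j h1 h2 h3 h4 h5 h6
    have e1 : m + 1 - (i - 1) = m + 1 - i + 1 := by ring
    have e2 : m + 1 - (i + 1) = m + 1 - i - 1 := by ring
    simp only [e1, e2] at *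
    exact h.below (by omega) (by omega) h3 h4 h5 h6
  below := by
    intro i j h1 h2 h3 h4 h5 h6
    have e1 : m + 1 - (i - 1) = m + 1 - i + 1 := by ring
    have e2 : m + 1 - (i + 1) = m + 1 - i - 1 := by ring
    simp only [e1, e2] at *
    exact h.above (by omega) (by omega) h3 h4 h5 h6
  left := by
    intro i j h1 h2 h3 h4 h5 h6
    have e1 : m + 1 - (i - 1) = m + 1 - i + 1 := by ring
    have e2 : m + 1 - (i + 1) = m + 1 - i - 1 := by ring
    simp only [e1, e2] at *
    have := h.left (by omega) (by omega) h3 h4 h5 h6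
    tauto
  right := by
    intro i j h1 h2 h3 h4 h5 h6
    have e1 : m + 1 - (i - 1) = m + 1 - i + 1 := by ring
    have e2 : m + 1 - (i + 1) = m + 1 - i - 1 := by ring
    simp only [e1, e2] at *
    have := h.right (by omega) (by omega) h3 h4 h5 h6
    tauto

theorem flipCols (h : GridFort m n W) : GridFort m n (fun i j => W i (n + 1 - j)) :=
  h.transpose.flipRows.transpose

/-- Every cell of a fort lies in the cone below a cell of the fort in the first row. -/
theorem exists_top_near (h : GridFort m n W) {i j : ℤ} (hij : W i j) :
    ∃ z, W 1 z ∧ |z - j| ≤ i - 1 := by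
  obtain ⟨k, rfl⟩ : ∃ k : ℕ, i = k + 1 :=
    ⟨(i - 1).toNat, by have := h.row_pos hij; omega⟩
  induction k using Nat.strong_induction_on generalizing j with
  | _ k ih =>
    rcases Nat.eq_zero_or_pos k with rfl | hk
    · exact ⟨j, by simpa using hij, by simp⟩
    have hc1 := h.col_pos hij
    have hc2 := h.col_le hij
    have hr2 := h.row_le hij
    have step : ∀ (k' : ℕ) (j' : ℤ), k' < k → |j' - j| + k' ≤ k → W (k' + 1) j' →
        ∃ z, W 1 z ∧ |z - j| ≤ (k : ℤ) + 1 - 1 := by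
      intro k' j' hk' hle hW'
      obtain ⟨z, hz, hz'⟩ := ih k' hk' hW'
      refine ⟨z, hz, ?_⟩
      have := abs_sub_le z j' j
      omega
    -- The cell above is in the fort or has a second neighbour in it; each alternative climbs at
    -- least as many rows as it moves sideways.
    by_cases hkj : W k j
    · exact step (k - 1) j (by omega) (by simp) (by convert hkj using 1; omega)
    · rcases h.below (by omega) (by omega) hc1 hc2 hkj hij with h1 | h1 | h1
      · have := h.row_pos h1
        exact step (k - 2) j (by omega) (by simp) (by convert h1 using 1; omega)
      · exact step (k - 1) (j - 1) (by omega) (by simp; omega) (by convert h1 using 1; omega)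
      · exact step (k - 1) (j + 1) (by omega) (by simp; omega) (by convert h1 using 1; omega)

end GridFort

/-! ### Distance from a set of integers, and its peaks -/

/-- The distance of the integer `j` from the set `Z`. -/
noncomputable def nearDist (Z : Set ℤ) (j : ℤ) : ℤ :=
  ((sInf {k : ℕ | ∃ z ∈ Z, (k : ℤ) = |z - j|} : ℕ) : ℤ)

theorem nearDist_le {Z : Set ℤ} {z : ℤ} (hz : z ∈ Z) (j : ℤ) : nearDist Z j ≤ |z - j| := by
  have : sInf {k : ℕ | ∃ z ∈ Z, (k : ℤ) = |z - j|} ≤ (z - j).natAbs :=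
    Nat.sInf_le ⟨z, hz, by simp⟩
  have h2 := Int.abs_eq_natAbs (z - j)
  unfold nearDist
  omega

theorem nearDist_nonneg (Z : Set ℤ) (j : ℤ) : 0 ≤ nearDist Z j := by
  unfold nearDist; omega

/-- Nonemptiness matters: for empty `Z` the infimum defaults to `0`. -/
theorem exists_nearDist {Z : Set ℤ} (hZ : Z.Nonempty) (j : ℤ) :
    ∃ z ∈ Z, nearDist Z j = |z - j| := by
  obtain ⟨z, hz⟩ := hZ
  exact Nat.sInf_mem (s := {k : ℕ | ∃ z ∈ Z, (k : ℤ) = |z - j|}) ⟨(z - j).natAbs, z, hz, by simp⟩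

theorem nearDist_mem {Z : Set ℤ} (hZ : Z.Nonempty) (j : ℤ) :
    j - nearDist Z j ∈ Z ∨ j + nearDist Z j ∈ Z := by
  obtain ⟨z, hz, hd⟩ := exists_nearDist hZ j
  rcases abs_cases (z - j) with ⟨h1, _⟩ | ⟨h1, _⟩
  · right; rw [hd, h1]; simpa using hz
  · left; rw [hd, h1]; simpa using hz

theorem nearDist_reflect (Z : Set ℤ) (c j : ℤ) :
    nearDist {z | c - z ∈ Z} j = nearDist Z (c - j) := by
  unfold nearDist
  congr 3
  ext k
  constructor
  · rintro ⟨z, hz, hk⟩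
    exact ⟨c - z, hz, by rw [hk, show c - z - (c - j) = -(z - j) by ring, abs_neg]⟩
  · rintro ⟨z, hz, hk⟩
    exact ⟨c - z, by simpa using hz,
      by rw [hk, show c - z - j = -(z - (c - j)) by ring, abs_neg]⟩

/-- The set of integers `j` that are equally close to two different elements of `Z` and to no other
element. -/
def IsPeak (Z : Set ℤ) (j : ℤ) : Prop :=
  j ∉ Z ∧ j - nearDist Z j ∈ Z ∧ j + nearDist Z j ∈ Z

theorem nearDist_eq_zero {Z : Set ℤ} {j : ℤ} (h : j ∈ Z) : nearDist Z j = 0 := by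
  have h1 := nearDist_le h j
  have h2 := nearDist_nonneg Z j
  simp at h1
  omega

theorem nearDist_pos {Z : Set ℤ} (hZ : Z.Nonempty) {j : ℤ} (h : j ∉ Z) : 1 ≤ nearDist Z j := by
  by_contra hc
  have h2 := nearDist_nonneg Z j
  have h0 : nearDist Z j = 0 := by omega
  rcases nearDist_mem hZ j with h1 | h1 <;> rw [h0] at h1 <;> simp at h1 <;> exact h h1

theorem IsPeak.one_le {Z : Set ℤ} {j : ℤ} (h : IsPeak Z j) : 1 ≤ nearDist Z j :=
  nearDist_pos ⟨_, h.2.1⟩ h.1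

theorem nearDist_le_of_le {Z : Set ℤ} {z j : ℤ} (hz : z ∈ Z) (h : z ≤ j) :
    nearDist Z j ≤ j - z := by
  have := nearDist_le hz j
  rw [abs_sub_comm, abs_of_nonneg (by omega)] at this
  exact this

theorem nearDist_le_of_ge {Z : Set ℤ} {z j : ℤ} (hz : z ∈ Z) (h : j ≤ z) :
    nearDist Z j ≤ z - j := by
  have := nearDist_le hz j
  rw [abs_of_nonneg (by omega)] at this
  exact this

theorem nearDist_succ_le {Z : Set ℤ} (hZ : Z.Nonempty) (j : ℤ) :
    nearDist Z (j + 1) ≤ nearDist Z j + 1 := by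
  obtain ⟨z, hz, hd⟩ := exists_nearDist hZ j
  have h1 := nearDist_le hz (j + 1)
  rcases abs_cases (z - j) with ⟨h2, _⟩ | ⟨h2, _⟩ <;>
  rcases abs_cases (z - (j + 1)) with ⟨h3, _⟩ | ⟨h3, _⟩ <;> omega

theorem le_nearDist_succ {Z : Set ℤ} (hZ : Z.Nonempty) (j : ℤ) :
    nearDist Z j ≤ nearDist Z (j + 1) + 1 := by
  obtain ⟨z, hz, hd⟩ := exists_nearDist hZ (j + 1)
  have h1 := nearDist_le hz j
  rcases abs_cases (z - j) with ⟨h2, _⟩ | ⟨h2, _⟩ <;>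
  rcases abs_cases (z - (j + 1)) with ⟨h3, _⟩ | ⟨h3, _⟩ <;> omega

/-- No element of `Z` lies strictly between `j` and a point at distance `nearDist Z j`. -/
theorem nearDist_le_iff {Z : Set ℤ} {z j : ℤ} (hz : z ∈ Z) :
    z ≤ j - nearDist Z j ∨ j + nearDist Z j ≤ z := by
  rcases le_total z j with h | h
  · left; have := nearDist_le_of_le hz h; omega
  · right; have := nearDist_le_of_ge hz h; omega

/-- Beside a peak the distance drops by one on both sides, so neighbours cannot both be peaks. -/
theorem IsPeak.not_succ {Z : Set ℤ} {j : ℤ} (h : IsPeak Z j) : ¬ IsPeak Z (j + 1) := by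
  intro h'
  have h1 := h.one_le
  have h2 := h'.one_le
  have a1 := nearDist_le_iff (j := j) h'.2.1
  have a2 := nearDist_le_iff (j := j) h'.2.2
  have a3 := nearDist_le_iff (j := j + 1) h.2.1
  have a4 := nearDist_le_iff (j := j + 1) h.2.2
  omega

/-! ### The envelopes of a fort -/

namespace GridFort

variable {m n : ℤ} {W : ℤ → ℤ → Prop}

theorem top_nonempty (h : GridFort m n W) : {z | W 1 z}.Nonempty := by
  obtain ⟨i, j, hij⟩ := h.nonempty
  obtain ⟨z, hz, -⟩ := h.exists_top_near hij
  exact ⟨z, hz⟩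

theorem top_le (h : GridFort m n W) {i j : ℤ} (hij : W i j) : 1 + nearDist {z | W 1 z} j ≤ i := by
  obtain ⟨z, hz, hle⟩ := h.exists_top_near hij
  have := nearDist_le (Z := {z | W 1 z}) hz j
  omega

/-- From the nearest first-row cell on the left the fort runs down a diagonal. The cell to the right
of a diagonal cell needs a second neighbour in the fort; those above and to the right are too high,
so the one below, the next diagonal cell, is present. -/
theorem mem_of_left (h : GridFort m n W) {j : ℤ} (hj : j ≤ n)
    (hl : j - nearDist {z | W 1 z} j ∈ {z | W 1 z}) :
    W (1 + nearDist {z | W 1 z} j) j ∨ j + nearDist {z | W 1 z} j ∈ {z | W 1 z} := by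
  set Z := {z | W 1 z} with hZ
  set d := nearDist Z j with hd
  have hd0 : 0 ≤ d := nearDist_nonneg Z j
  have hl1 : 1 ≤ j - d := h.col_pos (i := 1) hl
  by_cases hr : j + d ∈ Z
  · exact Or.inr hr
  left
  have key : ∀ k : ℕ, (k : ℤ) ≤ d → W (k + 1) (j - d + k) := by
    intro k
    induction k with
    | zero => intro _; simpa using (show W 1 (j - d) from hl)
    | succ k ih =>
      intro hk
      push_cast at hk ⊢
      have hk0 := ih (by omega)
      have far : ∀ c z, c ≤ j + 1 → j - d + k + 1 ≤ c → z ∈ Z → |z - c| ≤ k → False := by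
        intro c z hc hc' hz hzc
        have h1 := nearDist_le_iff (j := j) hz
        rw [← hd] at h1
        have h3 : z ≠ j + d := fun e => hr (e ▸ hz)
        rw [abs_le] at hzc
        omega
      -- A cell this high would need a first-row cell strictly between `j - d` and `j + d`.
      have nW : ∀ i c : ℤ, c ≤ j + 1 → j - d + k + 1 ≤ c → i ≤ k + 1 → ¬ W i c := by
        intro i c hc hc' hi hW
        obtain ⟨z, hz, hle⟩ := h.exists_top_near hW
        exact far c z hc hc' hz (by omega)
      have hm := h.row_le hk0
      have := h.left (i := (k : ℤ) + 1) (j := j - d + k + 1) (by omega) hm (by omega) (by omega)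
        (nW (k + 1) (j - d + k + 1) (by omega) (by omega) (by omega)) (by convert hk0 using 1; ring)
      rcases this with h1 | h1 | h1
      · exact absurd h1 (nW (k + 1 - 1) (j - d + k + 1) (by omega) (by omega) (by omega))
      · convert h1 using 1; ring
      · exact absurd h1 (nW (k + 1) (j - d + k + 1 + 1) (by omega) (by omega) (by omega))
  have := key d.toNat (by omega)
  rw [Int.toNat_of_nonneg hd0] at this
  convert this using 1 <;> ring

theorem top_flipCols (j : ℤ) :
    nearDist {z | W 1 (n + 1 - z)} j = nearDist {z | W 1 z} (n + 1 - j) :=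
  nearDist_reflect {z | W 1 z} (n + 1) j

/-- If the highest place that a column may occupy is not occupied, then it is a peak of the distance
from the first row of the fort. -/
theorem isPeak_top (h : GridFort m n W) {j : ℤ} (hj1 : 1 ≤ j) (hj : j ≤ n)
    (hs : ¬ W (1 + nearDist {z | W 1 z} j) j) : IsPeak {z | W 1 z} j := by
  refine ⟨fun hmem => ?_, ?_⟩
  · rw [nearDist_eq_zero hmem] at hs
    exact hs (by simpa using hmem)
  rcases nearDist_mem h.top_nonempty j with hl | hr
  · rcases h.mem_of_left hj hl with h1 | h1
    · exact absurd h1 hs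
    · exact ⟨hl, h1⟩
  · have e := top_flipCols (W := W) (n := n) (n + 1 - j)
    simp only [sub_sub_cancel] at e
    have := h.flipCols.mem_of_left (j := n + 1 - j) (by omega) (by
      rw [e]
      show W 1 _
      have h2 : W 1 _ := hr
      convert h2 using 1; ring)
    rw [e] at this
    simp only [sub_sub_cancel] at this
    rcases this with h1 | h1
    · exact absurd h1 hs
    · refine ⟨?_, hr⟩
      have h2 : W 1 _ := h1
      show W 1 _
      convert h2 using 1; ring

end GridFort

/-! ### Counting peaks -/

/-- The peaks and their right neighbours are disjoint sets inside `(u, v]`. -/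
theorem two_mul_card_peaks_le {Z : Set ℤ} {u v : ℤ} (huv : u ≤ v) (S : Finset ℤ)
    (hS : ∀ s ∈ S, IsPeak Z s ∧ u < s ∧ s < v) : 2 * (S.card : ℤ) ≤ v - u := by
  have hdisj : Disjoint S (S.image (· + 1)) := by
    rw [Finset.disjoint_left]
    intro a ha ha'
    obtain ⟨b, hb, rfl⟩ := Finset.mem_image.1 ha'
    exact (hS b hb).1.not_succ (hS _ ha).1
  have hsub : S ∪ S.image (· + 1) ⊆ Finset.Ioc u v := by
    intro a ha
    rcases Finset.mem_union.1 ha with ha | ha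
    · have := hS a ha
      rw [Finset.mem_Ioc]; omega
    · obtain ⟨b, hb, rfl⟩ := Finset.mem_image.1 ha
      have := hS b hb
      rw [Finset.mem_Ioc]; omega
  have hc := Finset.card_le_card hsub
  rw [Finset.card_union_of_disjoint hdisj,
    Finset.card_image_of_injective _ (add_left_injective (1 : ℤ)), Int.card_Ioc] at hc
  omega

theorem exists_max_mem {A : Set ℤ} {p z : ℤ} (hz : z ∈ A) (hzp : z ≤ p) :
    ∃ v ∈ A, v ≤ p ∧ z ≤ v ∧ ∀ y ∈ A, y ≤ p → y ≤ v := by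
  classical
  have hne : ((Finset.Icc z p).filter (· ∈ A)).Nonempty := ⟨z, by simp [hz, hzp]⟩
  have hm := Finset.max'_mem _ hne
  rw [Finset.mem_filter, Finset.mem_Icc] at hm
  refine ⟨_, hm.2, hm.1.2, hm.1.1, fun y hy hyp => ?_⟩
  rcases le_total z y with h | h
  · exact Finset.le_max' _ _ (by simp [hy, hyp, h])
  · exact h.trans hm.1.1

theorem exists_min_mem {A : Set ℤ} {p z : ℤ} (hz : z ∈ A) (hzp : p ≤ z) :
    ∃ v ∈ A, p ≤ v ∧ v ≤ z ∧ ∀ y ∈ A, p ≤ y → v ≤ y := by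
  classical
  have hne : ((Finset.Icc p z).filter (· ∈ A)).Nonempty := ⟨z, by simp [hz, hzp]⟩
  have hm := Finset.min'_mem _ hne
  rw [Finset.mem_filter, Finset.mem_Icc] at hm
  refine ⟨_, hm.2, hm.1.1, hm.1.2, fun y hy hyp => ?_⟩
  rcases le_total y z with h | h
  · exact Finset.min'_le _ _ (by simp [hy, hyp, h])
  · exact hm.1.2.trans h

/-- The last element of `A` up to `p`, when the distance of `p` from `A` is almost attained on the
left: all peaks before `p` come before it. -/
theorem exists_last_mem {A : Set ℤ} {p : ℤ}
    (hl : ∃ z ∈ A, z < p ∧ p - nearDist A p - 1 ≤ z) :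
    ∃ v ∈ A, v ≤ p ∧ v ≤ p - nearDist A p ∧ p - nearDist A p - 1 ≤ v ∧
      (∀ z ∈ A, z ≤ p → z ≤ v) ∧ ∀ s, s < p → IsPeak A s → s < v := by
  obtain ⟨z, hz, hzp, hzl⟩ := hl
  obtain ⟨v, hv, hvp, hzv, hmax⟩ := exists_max_mem hz hzp.le
  have hv' := nearDist_le_of_le hv hvp
  refine ⟨v, hv, hvp, by omega, by omega, hmax, fun s hs hpk => ?_⟩
  by_contra hvs
  have hne : s ≠ v := fun e => hpk.1 (e ▸ hv)
  have h1 := nearDist_le_iff (j := s) hv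
  have h2 := nearDist_le_iff (j := p) hpk.2.2
  have h3 := hmax _ hpk.2.2
  have h4 := hpk.one_le
  have h5 := hmax _ hpk.2.1
  have h6 := nearDist_nonneg A p
  omega

theorem exists_first_mem {A : Set ℤ} {p : ℤ}
    (hr : ∃ z ∈ A, p < z ∧ z ≤ p + nearDist A p + 1) :
    ∃ u ∈ A, p ≤ u ∧ p + nearDist A p ≤ u ∧ u ≤ p + nearDist A p + 1 ∧
      (∀ z ∈ A, p ≤ z → u ≤ z) ∧ ∀ s, p < s → IsPeak A s → u < s := by
  obtain ⟨z, hz, hzp, hzl⟩ := hr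
  obtain ⟨v, hv, hvp, hzv, hmax⟩ := exists_min_mem hz hzp.le
  have hv' := nearDist_le_of_ge hv hvp
  refine ⟨v, hv, hvp, by omega, by omega, hmax, fun s hs hpk => ?_⟩
  by_contra hvs
  have hne : s ≠ v := fun e => hpk.1 (e ▸ hv)
  have h1 := nearDist_le_iff (j := s) hv
  have h2 := nearDist_le_iff (j := p) hpk.2.1
  have h3 := hmax _ hpk.2.1
  have h4 := hpk.one_le
  have h5 := hmax _ hpk.2.2
  have h6 := nearDist_nonneg A p
  omega

/-- All these peaks lie between the first point `u` of `A` from `p` on and the last point `v` up to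
`p'`; the distances at `p` and `p'` shorten the interval `[u, v]`. -/
theorem two_mul_card_peaks_between_le {A : Set ℤ} {p p' : ℤ} (hpp : p + 2 ≤ p')
    (hr : ∃ z ∈ A, p < z ∧ z ≤ p + nearDist A p + 1)
    (hl : ∃ z ∈ A, z < p' ∧ p' - nearDist A p' - 1 ≤ z) (S : Finset ℤ)
    (hS : ∀ s ∈ S, IsPeak A s ∧ p < s ∧ s < p') :
    2 * (S.card : ℤ) ≤ p' - p - nearDist A p - nearDist A p' := by
  obtain ⟨u, hu, hpu, hpu', hup, humin, hus⟩ := exists_first_mem hr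
  obtain ⟨v, hv, hvp, hvp', hpv, hvmax, hsv⟩ := exists_last_mem hl
  have huv : u ≤ v := by
    by_contra hc
    have h1 := nearDist_le_iff (j := p) hv
    have h2 := nearDist_le_iff (j := p') hu
    have h3 : v < p := by
      by_contra h; exact hc (humin v hv (by omega))
    have h4 : p' < u := by
      by_contra h; exact hc (hvmax u hu (by omega))
    have h5 := nearDist_nonneg A p
    have h6 := nearDist_nonneg A p'
    omega
  have := two_mul_card_peaks_le huv S fun s hs =>
    ⟨(hS s hs).1, hus s (hS s hs).2.1 (hS s hs).1, hsv s (hS s hs).2.2 (hS s hs).1⟩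
  omega

theorem exists_mem_right_of_nearDist_le {A : Set ℤ} (hA : A.Nonempty) {p : ℤ}
    (hd : nearDist A (p + 1) ≤ nearDist A p) :
    ∃ z ∈ A, p < z ∧ z ≤ p + nearDist A p + 1 := by
  obtain ⟨z, hz, hzd⟩ := exists_nearDist hA (p + 1)
  have h1 := nearDist_le_iff (j := p) hz
  have h2 := nearDist_nonneg A p
  refine ⟨z, hz, ?_⟩
  rcases abs_cases (z - (p + 1)) with ⟨h3, _⟩ | ⟨h3, _⟩ <;> omega

theorem exists_mem_left_of_nearDist_le {A : Set ℤ} (hA : A.Nonempty) {p : ℤ}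
    (hd : nearDist A (p - 1) ≤ nearDist A p) :
    ∃ z ∈ A, z < p ∧ p - nearDist A p - 1 ≤ z := by
  obtain ⟨z, hz, hzd⟩ := exists_nearDist hA (p - 1)
  have h1 := nearDist_le_iff (j := p) hz
  have h2 := nearDist_nonneg A p
  refine ⟨z, hz, ?_⟩
  rcases abs_cases (z - (p - 1)) with ⟨h3, _⟩ | ⟨h3, _⟩ <;> omega

/-! ### Proper columns, empty columns and the excess between proper columns -/

/-- The column `j` holds exactly one cell, the one allowed by the distances from the first and the
last row. -/
def IsProperCol (m : ℤ) (W : ℤ → ℤ → Prop) (j : ℤ) : Prop :=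
  nearDist {z | W 1 z} j + nearDist {z | W m z} j = m - 1 ∧ W (1 + nearDist {z | W 1 z} j) j

open Classical in
/-- The number of cells in the column `j`. -/
noncomputable def colCard (m : ℤ) (W : ℤ → ℤ → Prop) (j : ℤ) : ℤ :=
  (((Finset.Icc 1 m).filter (fun i => W i j)).card : ℤ)

namespace GridFort

variable {m n : ℤ} {W : ℤ → ℤ → Prop}

theorem bot_nonempty (h : GridFort m n W) : {z | W m z}.Nonempty := by
  have := h.flipRows.top_nonempty
  simpa only [add_sub_cancel_right] using this

theorem le_bot (h : GridFort m n W) {i j : ℤ} (hij : W i j) :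
    i ≤ m - nearDist {z | W m z} j := by
  have := h.flipRows.top_le (i := m + 1 - i) (j := j) (by simpa using hij)
  simp only [add_sub_cancel_right] at this
  omega

theorem isPeak_bot (h : GridFort m n W) {j : ℤ} (hj1 : 1 ≤ j) (hj : j ≤ n)
    (hs : ¬ W (m - nearDist {z | W m z} j) j) : IsPeak {z | W m z} j := by
  have := h.flipRows.isPeak_top hj1 hj
  simp only [add_sub_cancel_right] at this
  exact this (by convert hs using 2; ring)

theorem one_le_rows (h : GridFort m n W) : 1 ≤ m := by
  obtain ⟨i, j, hij⟩ := h.nonempty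
  have := h.row_pos hij
  have := h.row_le hij
  omega

theorem one_le_cols (h : GridFort m n W) : 1 ≤ n := h.transpose.one_le_rows

theorem nearDist_add_le (h : GridFort m n W) {i j : ℤ} (hij : W i j) :
    nearDist {z | W 1 z} j + nearDist {z | W m z} j ≤ m - 1 := by
  have := h.top_le hij
  have := h.le_bot hij
  omega

theorem isProperCol_of_eq (h : GridFort m n W) {i j : ℤ} (hij : W i j)
    (he : nearDist {z | W 1 z} j + nearDist {z | W m z} j = m - 1) : IsProperCol m W j := by
  refine ⟨he, ?_⟩
  have := h.top_le hij
  have := h.le_bot hij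
  have e : i = 1 + nearDist {z | W 1 z} j := by omega
  rwa [← e]

theorem eq_of_isProperCol (h : GridFort m n W) {i j : ℤ} (hp : IsProperCol m W j) (hij : W i j) :
    i = 1 + nearDist {z | W 1 z} j := by
  have := h.top_le hij
  have := h.le_bot hij
  have := hp.1
  omega

theorem colCard_of_isProperCol (h : GridFort m n W) {j : ℤ} (hp : IsProperCol m W j) :
    colCard m W j = 1 := by
  classical
  unfold colCard
  rw [Nat.cast_eq_one, Finset.card_eq_one]
  refine ⟨1 + nearDist {z | W 1 z} j, ?_⟩
  ext i
  simp only [Finset.mem_filter, Finset.mem_Icc, Finset.mem_singleton]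
  constructor
  · exact fun hi => h.eq_of_isProperCol hp hi.2
  · rintro rfl
    exact ⟨⟨h.row_pos hp.2, h.row_le hp.2⟩, hp.2⟩

theorem colCard_of_empty {j : ℤ} (he : ∀ i, ¬ W i j) : colCard m W j = 0 := by
  simp [colCard, he]

/-- A cell of an empty column can have neighbours in the fort only to its left and right. -/
theorem empty_iff (h : GridFort m n W) {e : ℤ} (h1 : 1 ≤ e) (hn : e ≤ n) (he : ∀ i, ¬ W i e)
    (i : ℤ) : W i (e - 1) ↔ W i (e + 1) := by
  constructor <;> intro hi
  · have := h.left (h.row_pos hi) (h.row_le hi) h1 hn (he i) hi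
    simpa [he] using this
  · have := h.right (h.row_pos hi) (h.row_le hi) h1 hn (he i) hi
    simpa [he] using this

theorem nearDist_empty {A : Set ℤ} {e : ℤ} (hp : IsPeak A e) :
    nearDist A (e - 1) = nearDist A e - 1 ∧ nearDist A (e + 1) = nearDist A e - 1 := by
  have h0 := hp.one_le
  have hne : A.Nonempty := ⟨_, hp.2.1⟩
  have h1 := nearDist_le_of_le (j := e - 1) hp.2.1 (by omega)
  have h2 := nearDist_le_of_ge (j := e + 1) hp.2.2 (by omega)
  have h3 := nearDist_succ_le hne (e - 1)
  have h4 := le_nearDist_succ hne e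
  simp only [sub_add_cancel] at h3
  omega

/-- An empty column is a peak of both distances, so its two neighbours agree in their envelopes as
well as in their cells. -/
theorem isProperCol_empty_iff (h : GridFort m n W) {e : ℤ} (h1 : 1 ≤ e) (hn : e ≤ n)
    (he : ∀ i, ¬ W i e) : IsProperCol m W (e - 1) ↔ IsProperCol m W (e + 1) := by
  have h2 := nearDist_empty (h.isPeak_top h1 hn (he _))
  have h3 := nearDist_empty (h.isPeak_bot h1 hn (he _))
  unfold IsProperCol
  rw [h2.1, h2.2, h3.1, h3.2, h.empty_iff h1 hn he]

open Classical in
-- Each vacant envelope place is compensated by a summand `1`. If the envelopes coincide in a column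
-- that is not proper, their common place is vacant and is compensated twice.
theorem two_le_colCard_add (h : GridFort m n W) {j : ℤ} (hj : ¬ IsProperCol m W j)
    (F : Finset ℤ) (hF : ∀ i ∈ F, W i j ∧ i ≠ 1 + nearDist {z | W 1 z} j ∧
      i ≠ m - nearDist {z | W m z} j) :
    2 + (F.card : ℤ) ≤ colCard m W j + (if ¬ W (1 + nearDist {z | W 1 z} j) j then 1 else 0) +
      (if ¬ W (m - nearDist {z | W m z} j) j then 1 else 0) := by
  set a := 1 + nearDist {z | W 1 z} j with ha
  set b := m - nearDist {z | W m z} j with hb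
  have key : ∀ G : Finset ℤ, (∀ i ∈ G, W i j ∧ (i = a ∨ i = b)) →
      (F.card : ℤ) + G.card ≤ colCard m W j := by
    intro G hG
    have hd : Disjoint F G := by
      rw [Finset.disjoint_left]
      intro i hi hi'
      have h1 := hF i hi
      have h2 := hG i hi'
      tauto
    have hs : F ∪ G ⊆ (Finset.Icc 1 m).filter (fun i => W i j) := by
      intro i hi
      have : W i j := by
        rcases Finset.mem_union.1 hi with hi | hi
        · exact (hF i hi).1
        · exact (hG i hi).1
      simp [this, h.row_pos this, h.row_le this]
    have := Finset.card_le_card hs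
    rw [Finset.card_union_of_disjoint hd] at this
    unfold colCard
    omega
  by_cases hWa : W a j <;> by_cases hWb : W b j
  · have hab : a ≠ b := fun e => hj ⟨by omega, hWa⟩
    have := key {a, b} (by simp [hWa, hWb])
    rw [Finset.card_pair hab] at this
    simp only [hWa, hWb, not_true_eq_false, if_false]
    omega
  · have := key {a} (by simp [hWa])
    simp only [hWa, hWb, not_true_eq_false, not_false_eq_true, if_false, if_true]
    simp at this
    omega
  · have := key {b} (by simp [hWb])
    simp only [hWa, hWb, not_true_eq_false, not_false_eq_true, if_false, if_true]
    simp at this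
    omega
  · have := key ∅ (by simp)
    simp only [hWa, hWb, not_false_eq_true, if_true]
    simp at this
    omega

open Classical in
/-- The cells of a set of columns are at least two for each column, apart from the peaks, together
with any cells `E` off the upper and the lower envelope. -/
theorem two_mul_card_add_le_sum (h : GridFort m n W) (J : Finset ℤ)
    (hJ : ∀ j ∈ J, ¬ IsProperCol m W j) (E : Finset (ℤ × ℤ))
    (hE : ∀ x ∈ E, x.2 ∈ J ∧ W x.1 x.2 ∧ x.1 ≠ 1 + nearDist {z | W 1 z} x.2 ∧
      x.1 ≠ m - nearDist {z | W m z} x.2) :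
    2 * (J.card : ℤ) + E.card ≤ ∑ j ∈ J, colCard m W j +
      (J.filter (fun j => ¬ W (1 + nearDist {z | W 1 z} j) j)).card +
      (J.filter (fun j => ¬ W (m - nearDist {z | W m z} j) j)).card := by
  have hcard : E.card = ∑ j ∈ J, (E.filter (fun x => x.2 = j)).card :=
    Finset.card_eq_sum_card_fiberwise fun x hx => (hE x hx).1
  have hJc : 2 * (J.card : ℤ) = ∑ j ∈ J, (2 : ℤ) := by simp [mul_comm]
  rw [hcard, Finset.card_filter, Finset.card_filter, hJc]
  push_cast
  rw [← Finset.sum_add_distrib, ← Finset.sum_add_distrib, ← Finset.sum_add_distrib]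
  refine Finset.sum_le_sum fun j hj => ?_
  have hinj : Set.InjOn Prod.fst ((E.filter (fun x => x.2 = j) : Finset (ℤ × ℤ)) : Set (ℤ × ℤ)) := by
    intro x hx y hy hxy
    have h1 := (Finset.mem_filter.1 hx).2
    have h2 := (Finset.mem_filter.1 hy).2
    exact Prod.ext hxy (h1.trans h2.symm)
  have := h.two_le_colCard_add (hJ j hj) ((E.filter (fun x => x.2 = j)).image Prod.fst) (by
    intro i hi
    obtain ⟨x, hx, rfl⟩ := Finset.mem_image.1 hi
    obtain ⟨hx1, rfl⟩ := Finset.mem_filter.1 hx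
    exact (hE x hx1).2)
  rwa [Finset.card_image_of_injOn hinj] at this

/-- To the right of a proper column that is followed by a nonempty column that is not proper, both
distances are almost attained. -/
theorem exists_right (h : GridFort m n W) {p i : ℤ} (hp : IsProperCol m W p)
    (hi : W i (p + 1)) (hn : ¬ IsProperCol m W (p + 1)) :
    (∃ z ∈ {z | W 1 z}, p < z ∧ z ≤ p + nearDist {z | W 1 z} p + 1) ∧
    (∃ z ∈ {z | W m z}, p < z ∧ z ≤ p + nearDist {z | W m z} p + 1) := by
  have h1 := h.nearDist_add_le hi
  have h2 : nearDist {z | W 1 z} (p + 1) + nearDist {z | W m z} (p + 1) ≠ m - 1 :=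
    fun e => hn (h.isProperCol_of_eq hi e)
  have h3 := hp.1
  have h4 := le_nearDist_succ h.top_nonempty p
  have h5 := le_nearDist_succ h.bot_nonempty p
  exact ⟨exists_mem_right_of_nearDist_le h.top_nonempty (by omega),
    exists_mem_right_of_nearDist_le h.bot_nonempty (by omega)⟩

theorem exists_left (h : GridFort m n W) {p i : ℤ} (hp : IsProperCol m W p)
    (hi : W i (p - 1)) (hn : ¬ IsProperCol m W (p - 1)) :
    (∃ z ∈ {z | W 1 z}, z < p ∧ p - nearDist {z | W 1 z} p - 1 ≤ z) ∧
    (∃ z ∈ {z | W m z}, z < p ∧ p - nearDist {z | W m z} p - 1 ≤ z) := by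
  have h1 := h.nearDist_add_le hi
  have h2 : nearDist {z | W 1 z} (p - 1) + nearDist {z | W m z} (p - 1) ≠ m - 1 :=
    fun e => hn (h.isProperCol_of_eq hi e)
  have h3 := hp.1
  have h4 := nearDist_succ_le h.top_nonempty (p - 1)
  have h5 := nearDist_succ_le h.bot_nonempty (p - 1)
  rw [sub_add_cancel] at h4 h5
  exact ⟨exists_mem_left_of_nearDist_le h.top_nonempty (by omega),
    exists_mem_left_of_nearDist_le h.bot_nonempty (by omega)⟩

/-- Between two consecutive proper columns that are neither adjacent nor separated by an empty column
there are at least `m - 2` more cells than columns. -/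
theorem sum_gap (h : GridFort m n W) {p p' i i' : ℤ} (hp1 : 1 ≤ p) (hpn : p' ≤ n)
    (hpp : p + 2 ≤ p') (hp : IsProperCol m W p) (hp' : IsProperCol m W p')
    (hn : ∀ j, p < j → j < p' → ¬ IsProperCol m W j) (hi : W i (p + 1)) (hi' : W i' (p' - 1)) :
    m - 2 ≤ ∑ j ∈ Finset.Ioo p p', (colCard m W j - 1) := by
  classical
  obtain ⟨hrt, hrb⟩ := h.exists_right hp hi (hn _ (by omega) (by omega))
  obtain ⟨hlt, hlb⟩ := h.exists_left hp' hi' (hn _ (by omega) (by omega))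
  have hmain := h.two_mul_card_add_le_sum (Finset.Ioo p p')
    (fun j hj => hn j (Finset.mem_Ioo.1 hj).1 (Finset.mem_Ioo.1 hj).2) ∅ (by simp)
  have hst := two_mul_card_peaks_between_le hpp hrt hlt
    ((Finset.Ioo p p').filter (fun j => ¬ W (1 + nearDist {z | W 1 z} j) j)) (by
      intro s hs
      rw [Finset.mem_filter, Finset.mem_Ioo] at hs
      exact ⟨h.isPeak_top (by omega) (by omega) hs.2, hs.1⟩)
  have hsb := two_mul_card_peaks_between_le hpp hrb hlb
    ((Finset.Ioo p p').filter (fun j => ¬ W (m - nearDist {z | W m z} j) j)) (by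
      intro s hs
      rw [Finset.mem_filter, Finset.mem_Ioo] at hs
      exact ⟨h.isPeak_bot (by omega) (by omega) hs.2, hs.1⟩)
  -- The four distances at `p` and `p'` add up to `2 * (m - 1)`, so there are at most `p' - p - (m -
  -- 1)` vacancies in `p' - p - 1` columns.
  have e1 := hp.1
  have e2 := hp'.1
  rw [Finset.sum_sub_distrib]
  rw [Int.card_Ioo] at hmain
  simp only [Finset.sum_const, Int.card_Ioo, Finset.card_empty, nsmul_eq_mul, mul_one] at hmain ⊢
  push_cast at hmain
  omega

end GridFort

/-! ### The stretch at an end of the board -/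

/-- Of the points strictly between the ends `a < b` of `A`, at most half are peaks or are as far from
`A` as from an end, provided that `A` has further points if both ends are to be considered. -/
theorem two_mul_card_le_of_peak_or {A : Set ℤ} {a b : ℤ} (hab : a < b) (ha : a ∈ A) (hb : b ∈ A)
    (P Q : Prop) (hPQ : P → Q → ∃ y ∈ A, a < y ∧ y < b) (X : Finset ℤ)
    (hX : ∀ r ∈ X, (a < r ∧ r < b) ∧
      (IsPeak A r ∨ (P ∧ nearDist A r = r - a) ∨ (Q ∧ nearDist A r = b - r))) :
    2 * (X.card : ℤ) ≤ b - a := by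
  classical
  -- `a'` is the successor of `a` in `A` if `P` holds and `a` itself otherwise; `b'` is chosen
  -- likewise. The point given by `hPQ` ensures `a' ≤ b'`.
  obtain ⟨a', b', ha', hb', haa, hab', hbb, hP, hP', hQ, hQ'⟩ :
      ∃ a' b', a' ∈ A ∧ b' ∈ A ∧ a ≤ a' ∧ a' ≤ b' ∧ b' ≤ b ∧
        (P → a < a' ∧ ∀ y ∈ A, a < y → a' ≤ y) ∧ (¬ P → a' = a) ∧
        (Q → b' < b ∧ ∀ y ∈ A, y < b → y ≤ b') ∧ (¬ Q → b' = b) := by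
    obtain ⟨a', ha1, ha2, ha3, ha4⟩ := exists_min_mem (p := a + 1) hb (by omega)
    obtain ⟨b', hb1, hb2, hb3, hb4⟩ := exists_max_mem (p := b - 1) ha (by omega)
    by_cases hP : P <;> by_cases hQ : Q
    · obtain ⟨y, hy, hy1, hy2⟩ := hPQ hP hQ
      have := ha4 y hy (by omega)
      have := hb4 y hy (by omega)
      exact ⟨a', b', ha1, hb1, by omega, by omega, by omega,
        fun _ => ⟨by omega, fun y hy h => ha4 y hy (by omega)⟩, fun h => absurd hP h,
        fun _ => ⟨by omega, fun y hy h => hb4 y hy (by omega)⟩, fun h => absurd hQ h⟩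
    · exact ⟨a', b, ha1, hb, by omega, by omega, by omega,
        fun _ => ⟨by omega, fun y hy h => ha4 y hy (by omega)⟩, fun h => absurd hP h,
        fun h => absurd h hQ, fun _ => rfl⟩
    · exact ⟨a, b', ha, hb1, by omega, by omega, by omega, fun h => absurd h hP, fun _ => rfl,
        fun _ => ⟨by omega, fun y hy h => hb4 y hy (by omega)⟩, fun h => absurd hQ h⟩
    · exact ⟨a, b, ha, hb, by omega, by omega, by omega, fun h => absurd h hP, fun _ => rfl,
        fun h => absurd h hQ, fun _ => rfl⟩
  -- Three pieces, each at most half filled: up to the midpoint of `a` and `a'`, peaks between `a'`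
  -- and `b'`, and from the midpoint of `b'` and `b` on.
  have hsub : X ⊆ Finset.Ioc a ((a + a') / 2) ∪
      X.filter (fun r => IsPeak A r ∧ a' < r ∧ r < b') ∪ Finset.Ico ((b' + b + 1) / 2) b := by
    intro r hr
    obtain ⟨⟨har, hrb⟩, hcase⟩ := hX r hr
    suffices 2 * r ≤ a + a' ∨ (IsPeak A r ∧ a' < r ∧ r < b') ∨ b' + b ≤ 2 * r by
      simp only [Finset.mem_union, Finset.mem_Ioc, Finset.mem_Ico, Finset.mem_filter]
      rcases this with h | h | h
      · left; left; omega
      · left; right; exact ⟨hr, h⟩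
      · right; omega
    have h1 := nearDist_le_iff (j := r) ha
    have h2 := nearDist_le_iff (j := r) hb
    have h3 := nearDist_le_iff (j := r) ha'
    have h4 := nearDist_le_iff (j := r) hb'
    rcases hcase with hpk | ⟨hp, hd⟩ | ⟨hq, hd⟩
    · have hd := hpk.one_le
      have hra : r ≠ a' := fun e => hpk.1 (e ▸ ha')
      have hrb' : r ≠ b' := fun e => hpk.1 (e ▸ hb')
      rcases lt_or_gt_of_ne hra with hlt | hgt
      · left
        by_cases hp : P
        · have := (hP hp).2 _ hpk.2.1
          omega
        · have := hP' hp; omega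
      · rcases lt_or_gt_of_ne hrb' with hlt' | hgt'
        · exact Or.inr (Or.inl ⟨hpk, hgt, hlt'⟩)
        · right; right
          by_cases hq : Q
          · have := (hQ hq).2 _ hpk.2.2
            omega
          · have := hQ' hq; omega
    · have := hP hp
      left; omega
    · have := hQ hq
      right; right; omega
  have hc := (Finset.card_le_card hsub).trans
    ((Finset.card_union_le _ _).trans (Nat.add_le_add_right (Finset.card_union_le _ _) _))
  rw [Int.card_Ioc, Int.card_Ico] at hc
  have hpk := two_mul_card_peaks_le hab' (X.filter (fun r => IsPeak A r ∧ a' < r ∧ r < b'))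
    fun s hs => (Finset.mem_filter.1 hs).2
  omega

/-- For a corner first column: `A` comes from the first or last row, `S` are vacancies of its
envelope, and `X` are the rows where the diagonal from the corner runs along that envelope. With `t`
the second point of `A`, `X` stays within the midpoint of `1` and `t`, while peaks other than that
midpoint lie beyond `t`. -/
theorem two_mul_card_add_card_peaks_le {A : Set ℤ} {m v : ℤ} (hm : 2 ≤ m) (h1 : (1 : ℤ) ∈ A)
    (hA : ∀ z ∈ A, 1 ≤ z) (hv : v ∈ A) (hv1 : 1 < v) (S X : Finset ℤ)
    (hS : ∀ s ∈ S, IsPeak A s ∧ s < v ∧ (2 * s ≤ m → nearDist A s ≠ s - 1))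
    (hX : ∀ r ∈ X, 2 ≤ r ∧ 2 * r ≤ m ∧ nearDist A r = r - 1) :
    2 * (X.card : ℤ) + 2 * S.card ≤ v - m % 2 := by
  classical
  obtain ⟨t, ht, ht1, htv, htmin⟩ := exists_min_mem (p := 2) hv (by omega)
  have hS1 : ∀ s ∈ S, s < t → 2 * s = 1 + t ∧ m ≤ t := by
    intro s hs hst
    obtain ⟨hpk, hsv, hne⟩ := hS s hs
    have e1 := nearDist_le_iff (j := s) h1
    have e2 := nearDist_le_iff (j := s) ht
    have e3 := hA _ hpk.2.1
    have e4 := hpk.one_le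
    have e5 := htmin _ hpk.2.2
    have e6 := htmin _ hpk.2.1
    omega
  have hS2 := two_mul_card_peaks_le htv (S.filter (fun s => t < s)) (by
    intro s hs
    obtain ⟨hs1, hs2⟩ := Finset.mem_filter.1 hs
    exact ⟨(hS s hs1).1, hs2, (hS s hs1).2.1⟩)
  have hS3 : (S.filter (fun s => ¬ t < s)).card ≤ 1 := by
    rw [Finset.card_le_one]
    intro x hx y hy
    rw [Finset.mem_filter] at hx hy
    have hxt : x ≠ t := fun e => (hS x hx.1).1.1 (e ▸ ht)
    have hyt : y ≠ t := fun e => (hS y hy.1).1.1 (e ▸ ht)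
    have := hS1 x hx.1 (by omega)
    have := hS1 y hy.1 (by omega)
    omega
  have hS4 := Finset.card_filter_add_card_filter_not (s := S) (fun s => t < s)
  have hXr : ∀ r ∈ X, 2 * r ≤ 1 + t := by
    intro r hr
    obtain ⟨e1, e2, e3⟩ := hX r hr
    have e4 := nearDist_le_iff (j := r) ht
    omega
  -- If `t < m`, the midpoint of `1` and `t` is not in `S`, since the diagonal fills it. If `t ≥ m`,
  -- it may be, but then `2 * r ≤ m` keeps `X` small enough.
  rcases lt_or_ge t m with htm | htm
  · have hS5 : (S.filter (fun s => ¬ t < s)).card = 0 := by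
      rw [Finset.card_eq_zero, Finset.filter_eq_empty_iff]
      intro x hx hxt
      have hxt' : x ≠ t := fun e => (hS x hx).1.1 (e ▸ ht)
      have := hS1 x hx (by omega)
      omega
    have hXc : X ⊆ Finset.Icc 2 ((1 + t) / 2) := by
      intro r hr
      have := hX r hr
      have := hXr r hr
      rw [Finset.mem_Icc]; omega
    have := Finset.card_le_card hXc
    rw [Int.card_Icc] at this
    omega
  · have hXc : X ⊆ Finset.Icc 2 (m / 2) := by
      intro r hr
      have := hX r hr
      rw [Finset.mem_Icc]; omega
    have := Finset.card_le_card hXc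
    rw [Int.card_Icc] at this
    omega

open Classical in
/-- The cells nearest to the first column in the rows strictly between the first and the last cell of
the first column, as far as they lie on neither the upper nor the lower envelope. -/
noncomputable def leftExtra (m : ℤ) (W : ℤ → ℤ → Prop) : Finset (ℤ × ℤ) :=
  ((Finset.Ioo (1 + nearDist {z | W 1 z} 1) (m - nearDist {z | W m z} 1)).image
    (fun r => (r, 1 + nearDist {z | W z 1} r))).filter
      (fun x => W x.1 x.2 ∧ x.1 ≠ 1 + nearDist {z | W 1 z} x.2 ∧
        x.1 ≠ m - nearDist {z | W m z} x.2)

open Classical in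
theorem card_leftExtra_add (m : ℤ) (W : ℤ → ℤ → Prop) :
    ((leftExtra m W).card : ℤ) +
      ((Finset.Ioo (1 + nearDist {z | W 1 z} 1) (m - nearDist {z | W m z} 1)).filter (fun r =>
        ¬ (W r (1 + nearDist {z | W z 1} r) ∧
          r ≠ 1 + nearDist {z | W 1 z} (1 + nearDist {z | W z 1} r) ∧
          r ≠ m - nearDist {z | W m z} (1 + nearDist {z | W z 1} r)))).card =
    (Finset.Ioo (1 + nearDist {z | W 1 z} 1) (m - nearDist {z | W m z} 1)).card := by
  unfold leftExtra
  rw [Finset.filter_image, Finset.card_image_of_injective _ (fun x y h => (Prod.ext_iff.1 h).1)]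
  exact_mod_cast Finset.card_filter_add_card_filter_not
    (s := Finset.Ioo (1 + nearDist {z | W 1 z} 1) (m - nearDist {z | W m z} 1)) _

namespace GridFort

variable {m n : ℤ} {W : ℤ → ℤ → Prop}

/-- A peak has points of the set on both sides, so the first column is no peak and its envelope
places are occupied. -/
theorem first_col (h : GridFort m n W) : W (1 + nearDist {z | W 1 z} 1) 1 ∧
    W (m - nearDist {z | W m z} 1) 1 ∧ W 1 (1 + nearDist {z | W 1 z} 1) ∧
    W m (1 + nearDist {z | W m z} 1) := by
  have hn := h.one_le_cols
  refine ⟨?_, ?_, ?_, ?_⟩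
  · by_contra hc
    have hp := h.isPeak_top le_rfl hn hc
    have h1 : (1 : ℤ) ≤ _ := h.col_pos (i := 1) hp.2.1
    have := hp.one_le
    omega
  · by_contra hc
    have hp := h.isPeak_bot le_rfl hn hc
    have h1 : (1 : ℤ) ≤ _ := h.col_pos (i := m) hp.2.1
    have := hp.one_le
    omega
  · rcases nearDist_mem h.top_nonempty 1 with h1 | h1
    · have h2 : (1 : ℤ) ≤ _ := h.col_pos (i := 1) h1
      have h3 := nearDist_nonneg {z | W 1 z} 1
      have e : nearDist {z | W 1 z} 1 = 0 := by omega
      rw [e] at h1 ⊢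
      exact h1
    · exact h1
  · rcases nearDist_mem h.bot_nonempty 1 with h1 | h1
    · have h2 : (1 : ℤ) ≤ _ := h.col_pos (i := m) h1
      have h3 := nearDist_nonneg {z | W m z} 1
      have e : nearDist {z | W m z} 1 = 0 := by omega
      rw [e] at h1 ⊢
      exact h1
    · exact h1

theorem first_top_le (h : GridFort m n W) {z : ℤ} (hz : W 1 z) :
    1 + nearDist {z | W 1 z} 1 ≤ z := by
  have := nearDist_le_of_ge (Z := {z | W 1 z}) hz (h.col_pos hz)
  omega

theorem first_bot_le (h : GridFort m n W) {z : ℤ} (hz : W m z) :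
    1 + nearDist {z | W m z} 1 ≤ z := by
  have := nearDist_le_of_ge (Z := {z | W m z}) hz (h.col_pos hz)
  omega

theorem of_mem_leftExtra (h : GridFort m n W) {x : ℤ × ℤ} (hx : x ∈ leftExtra m W) :
    W x.1 x.2 ∧ x.1 ≠ 1 + nearDist {z | W 1 z} x.2 ∧ x.1 ≠ m - nearDist {z | W m z} x.2 ∧
      2 * (x.2 - 1) ≤ m - nearDist {z | W m z} 1 - (1 + nearDist {z | W 1 z} 1) := by
  classical
  unfold leftExtra at hx
  rw [Finset.mem_filter, Finset.mem_image] at hx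
  obtain ⟨⟨r, hr, rfl⟩, h1, h2, h3⟩ := hx
  rw [Finset.mem_Ioo] at hr
  refine ⟨h1, h2, h3, ?_⟩
  obtain ⟨c1, c2, -, -⟩ := h.first_col
  have e1 := nearDist_le_of_le (Z := {z | W z 1}) c1 hr.1.le
  have e2 := nearDist_le_of_ge (Z := {z | W z 1}) c2 hr.2.le
  simp only
  omega

/-- The rows between the ends of the first column that do not contribute to `leftExtra`. -/
theorem not_leftExtra_row (h : GridFort m n W) {r : ℤ}
    (hr1 : 1 + nearDist {z | W 1 z} 1 < r) (hr2 : r < m - nearDist {z | W m z} 1)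
    (hr : ¬ (W r (1 + nearDist {z | W z 1} r) ∧
          r ≠ 1 + nearDist {z | W 1 z} (1 + nearDist {z | W z 1} r) ∧
          r ≠ m - nearDist {z | W m z} (1 + nearDist {z | W z 1} r))) :
    IsPeak {z | W z 1} r ∨
    (nearDist {z | W 1 z} 1 = 0 ∧ nearDist {z | W z 1} r = r - 1 ∧
      nearDist {z | W 1 z} r = r - 1) ∨
    (nearDist {z | W m z} 1 = 0 ∧ nearDist {z | W z 1} r = m - r ∧
      nearDist {z | W m z} (m + 1 - r) = m - r) := by
  obtain ⟨c1, c2, c3, c4⟩ := h.first_col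
  have n1 := nearDist_nonneg {z | W 1 z} 1
  have n2 := nearDist_nonneg {z | W m z} 1
  have n3 := nearDist_nonneg {z | W z 1} r
  have e1 := nearDist_le_of_le (Z := {z | W z 1}) c1 hr1.le
  have e2 := nearDist_le_of_ge (Z := {z | W z 1}) c2 hr2.le
  by_cases hW : W r (1 + nearDist {z | W z 1} r)
  · right
    have hr' : r = 1 + nearDist {z | W 1 z} (1 + nearDist {z | W z 1} r) ∨
        r = m - nearDist {z | W m z} (1 + nearDist {z | W z 1} r) := by tauto
    rcases hr' with hr' | hr'
    · left
      have h3 := nearDist_le_iff (Z := {z | W 1 z}) (j := 1 + nearDist {z | W z 1} r) c3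
      have h4 : nearDist {z | W 1 z} 1 = 0 := by omega
      have h5 : nearDist {z | W z 1} r = r - 1 := by omega
      refine ⟨h4, h5, ?_⟩
      rw [h5, add_sub_cancel] at hr'
      omega
    · right
      have h3 := nearDist_le_iff (Z := {z | W m z}) (j := 1 + nearDist {z | W z 1} r) c4
      have h4 : nearDist {z | W m z} 1 = 0 := by omega
      have h5 : nearDist {z | W z 1} r = m - r := by omega
      refine ⟨h4, h5, ?_⟩
      rw [h5, show 1 + (m - r) = m + 1 - r by ring] at hr'
      omega
  · left
    exact h.transpose.isPeak_top (by omega) (by omega) hW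

/-- The first column consists of the two corners. -/
def _root_.IsCornerCol (m : ℤ) (W : ℤ → ℤ → Prop) : Prop :=
  3 ≤ m ∧ W 1 1 ∧ W m 1 ∧ ∀ r, W r 1 → r = 1 ∨ r = m

/-- Rows are lost only at peaks of the distance along the first column or on a diagonal from a
corner, by `not_leftExtra_row`, hence at most half of them. A corner column is excluded because
there the two diagonals may use up all rows. -/
theorem le_two_mul_card_leftExtra (h : GridFort m n W) (hc : ¬ IsCornerCol m W) :
    m - nearDist {z | W m z} 1 - (1 + nearDist {z | W 1 z} 1) - 2 ≤
      2 * ((leftExtra m W).card : ℤ) := by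
  classical
  obtain ⟨c1, c2, c3, c4⟩ := h.first_col
  rcases lt_or_ge (1 + nearDist {z | W 1 z} 1) (m - nearDist {z | W m z} 1) with hab | hab
  swap
  · omega
  by_cases hm : m ≤ 2
  · have := nearDist_nonneg {z | W 1 z} 1
    have := nearDist_nonneg {z | W m z} 1
    omega
  have hcard := card_leftExtra_add m W
  have hX := two_mul_card_le_of_peak_or (A := {z | W z 1}) hab c1 c2
    (nearDist {z | W 1 z} 1 = 0) (nearDist {z | W m z} 1 = 0) (by
      intro e1 e2
      by_contra hno
      apply hc
      rw [e1] at c1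
      rw [e2] at c2
      refine ⟨by omega, by simpa using c1, by simpa using c2, fun r hr => ?_⟩
      have hr1 := h.row_pos hr
      have hr2 := h.row_le hr
      by_contra hne
      exact hno ⟨r, hr, by omega, by omega⟩)
    ((Finset.Ioo (1 + nearDist {z | W 1 z} 1) (m - nearDist {z | W m z} 1)).filter (fun r =>
        ¬ (W r (1 + nearDist {z | W z 1} r) ∧
          r ≠ 1 + nearDist {z | W 1 z} (1 + nearDist {z | W z 1} r) ∧
          r ≠ m - nearDist {z | W m z} (1 + nearDist {z | W z 1} r)))) (by
      intro r hr
      rw [Finset.mem_filter, Finset.mem_Ioo] at hr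
      refine ⟨hr.1, ?_⟩
      rcases h.not_leftExtra_row hr.1.1 hr.1.2 hr.2 with h1 | h1 | h1
      · exact Or.inl h1
      · exact Or.inr (Or.inl ⟨h1.1, by omega⟩)
      · exact Or.inr (Or.inr ⟨h1.1, by omega⟩))
  rw [Int.card_Ioo] at hcard
  omega

end GridFort

namespace GridFort

variable {m n : ℤ} {W : ℤ → ℤ → Prop}

/-- In the presence of a first column made of the two corners, the cells nearest to the first column
lie on the two diagonals from the corners. -/
theorem corner_nearDist (hc : IsCornerCol m W) {r : ℤ} (h1 : 1 ≤ r) (hm : r ≤ m) :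
    (nearDist {z | W z 1} r = r - 1 ∧ 2 * r ≤ m + 1) ∨
    (nearDist {z | W z 1} r = m - r ∧ m + 1 ≤ 2 * r) := by
  obtain ⟨-, c1, c2, c3⟩ := hc
  have e1 := nearDist_le_of_le (Z := {z | W z 1}) c1 h1
  have e2 := nearDist_le_of_ge (Z := {z | W z 1}) c2 hm
  have e0 := nearDist_nonneg {z | W z 1} r
  rcases nearDist_mem (Z := {z | W z 1}) ⟨1, c1⟩ r with e3 | e3 <;>
    rcases c3 _ e3 with e4 | e4 <;> omega

/-- The envelope seen from the first column consists of the two diagonals from the corners; its only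
possible peak is the middle row, which `2 * s ≤ m` excludes. -/
theorem corner_diag (h : GridFort m n W) (hc : IsCornerCol m W) {s : ℤ} (h1 : 1 ≤ s)
    (hs : 2 * s ≤ m) : W s s ∧ W (m + 1 - s) s := by
  have hc' := hc
  obtain ⟨-, c1, c2, c3⟩ := hc'
  constructor
  · have e := corner_nearDist hc h1 (by omega)
    have e' : nearDist {z | W z 1} s = s - 1 := by omega
    by_contra hW
    have hp := h.transpose.isPeak_top h1 (by omega) (by
      show ¬ W s (1 + nearDist {z | W z 1} s)
      rwa [e', add_sub_cancel])
    have h3 : s + nearDist {z | W z 1} s = 1 ∨ s + nearDist {z | W z 1} s = m := c3 _ hp.2.2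
    have := hp.one_le
    omega
  · have e := corner_nearDist hc (r := m + 1 - s) (by omega) (by omega)
    have e' : nearDist {z | W z 1} (m + 1 - s) = s - 1 := by omega
    by_contra hW
    have hp := h.transpose.isPeak_top (j := m + 1 - s) (by omega) (by omega) (by
      show ¬ W (m + 1 - s) (1 + nearDist {z | W z 1} (m + 1 - s))
      rwa [e', add_sub_cancel])
    have h3 : m + 1 - s - nearDist {z | W z 1} (m + 1 - s) = 1 ∨
      m + 1 - s - nearDist {z | W z 1} (m + 1 - s) = m := c3 _ hp.2.1
    have := hp.one_le
    omega

open Classical in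
-- A row is lost only if a diagonal coincides there with the upper envelope (`T`) or the lower one
-- (`B`, counted from below), or if it is the middle row for odd `m`.
theorem corner_card_leftExtra (h : GridFort m n W) (hc : IsCornerCol m W) {T B : Finset ℤ}
    (hT : ∀ r, 2 ≤ r → 2 * r ≤ m → nearDist {z | W 1 z} r = r - 1 → r ∈ T)
    (hB : ∀ r, 2 ≤ r → 2 * r ≤ m → nearDist {z | W m z} r = r - 1 → r ∈ B) :
    m - 2 ≤ ((leftExtra m W).card : ℤ) + T.card + B.card + m % 2 := by
  have hc' := hc
  obtain ⟨hm, c1, c2, c3⟩ := hc'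
  have n1 : nearDist {z | W 1 z} 1 = 0 := nearDist_eq_zero c1
  have n2 : nearDist {z | W m z} 1 = 0 := nearDist_eq_zero c2
  have hcard := card_leftExtra_add m W
  have hsub : ((Finset.Ioo (1 + nearDist {z | W 1 z} 1) (m - nearDist {z | W m z} 1)).filter
      (fun r => ¬ (W r (1 + nearDist {z | W z 1} r) ∧
          r ≠ 1 + nearDist {z | W 1 z} (1 + nearDist {z | W z 1} r) ∧
          r ≠ m - nearDist {z | W m z} (1 + nearDist {z | W z 1} r)))) ⊆
      (T ∪ B.image (fun r => m + 1 - r)) ∪ (if m % 2 = 1 then {(m + 1) / 2} else ∅) := by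
    intro r hr
    rw [Finset.mem_filter, Finset.mem_Ioo] at hr
    obtain ⟨⟨hr1, hr2⟩, hr3⟩ := hr
    have hcase := h.not_leftExtra_row hr1 hr2 hr3
    rw [n1] at hr1
    rw [n2] at hr2
    have e := corner_nearDist hc (r := r) (by omega) (by omega)
    simp only [Finset.mem_union, Finset.mem_image]
    by_cases hmid : 2 * r = m + 1
    · right
      rw [if_pos (by omega), Finset.mem_singleton]
      omega
    · left
      rcases hcase with hp | ⟨-, h1, h2⟩ | ⟨-, h1, h2⟩
      · exfalso
        have h3 : r - nearDist {z | W z 1} r = 1 ∨ r - nearDist {z | W z 1} r = m := c3 _ hp.2.1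
        have h4 : r + nearDist {z | W z 1} r = 1 ∨ r + nearDist {z | W z 1} r = m := c3 _ hp.2.2
        omega
      · exact Or.inl (hT r (by omega) (by omega) h2)
      · exact Or.inr ⟨m + 1 - r, hB _ (by omega) (by omega) (by omega), by ring⟩
  have hle := (Finset.card_le_card hsub).trans
    ((Finset.card_union_le _ _).trans (Nat.add_le_add_right
      ((Finset.card_union_le _ _).trans (Nat.add_le_add_left Finset.card_image_le _)) _))
  have hif : ((if m % 2 = 1 then {(m + 1) / 2} else ∅ : Finset ℤ).card : ℤ) ≤ m % 2 := by
    split_ifs with hif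
    · simp [hif]
    · simp; omega
  rw [Int.card_Ioo] at hcard
  omega

theorem isPeak_top_gt (h : GridFort m n W) {s : ℤ} (hs : IsPeak {z | W 1 z} s) :
    1 + nearDist {z | W 1 z} 1 < s := by
  have := h.first_top_le hs.2.1
  have := hs.one_le
  omega

theorem isPeak_bot_gt (h : GridFort m n W) {s : ℤ} (hs : IsPeak {z | W m z} s) :
    1 + nearDist {z | W m z} 1 < s := by
  have := h.first_bot_le hs.2.1
  have := hs.one_le
  omega

open Classical in
theorem card_spikes_top_le (h : GridFort m n W) (J : Finset ℤ) (hJ : ∀ j ∈ J, 1 ≤ j ∧ j ≤ n)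
    {v : ℤ} (hv : W 1 v) (hvs : ∀ s ∈ J, IsPeak {z | W 1 z} s → s < v) :
    2 * ((J.filter (fun j => ¬ W (1 + nearDist {z | W 1 z} j) j)).card : ℤ) ≤
      v - (1 + nearDist {z | W 1 z} 1) := by
  refine two_mul_card_peaks_le (Z := {z | W 1 z}) (h.first_top_le hv) _ fun s hs => ?_
  rw [Finset.mem_filter] at hs
  have hp := h.isPeak_top (hJ s hs.1).1 (hJ s hs.1).2 hs.2
  exact ⟨hp, h.isPeak_top_gt hp, hvs s hs.1 hp⟩

open Classical in
theorem card_spikes_bot_le (h : GridFort m n W) (J : Finset ℤ) (hJ : ∀ j ∈ J, 1 ≤ j ∧ j ≤ n)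
    {v : ℤ} (hv : W m v) (hvs : ∀ s ∈ J, IsPeak {z | W m z} s → s < v) :
    2 * ((J.filter (fun j => ¬ W (m - nearDist {z | W m z} j) j)).card : ℤ) ≤
      v - (1 + nearDist {z | W m z} 1) := by
  refine two_mul_card_peaks_le (Z := {z | W m z}) (h.first_bot_le hv) _ fun s hs => ?_
  rw [Finset.mem_filter] at hs
  have hp := h.isPeak_bot (hJ s hs.1).1 (hJ s hs.1).2 hs.2
  exact ⟨hp, h.isPeak_bot_gt hp, hvs s hs.1 hp⟩

open Classical in
/-- The balance at the first column: the cells of `leftExtra` make up for the columns in which the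
upper or the lower envelope is missing. -/
theorem left_balance (h : GridFort m n W) (J : Finset ℤ) (hJ : ∀ j ∈ J, 1 ≤ j ∧ j ≤ n)
    {v w : ℤ} (hv : W 1 v) (hvs : ∀ s ∈ J, IsPeak {z | W 1 z} s → s < v)
    (hw : W m w) (hws : ∀ s ∈ J, IsPeak {z | W m z} s → s < w)
    (hc : IsCornerCol m W → 1 < v ∨ 1 < w) :
    2 * ((J.filter (fun j => ¬ W (1 + nearDist {z | W 1 z} j) j)).card : ℤ) +
      2 * (J.filter (fun j => ¬ W (m - nearDist {z | W m z} j) j)).card + (m - 1) ≤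
      2 * (leftExtra m W).card + v + w := by
  by_cases hcc : IsCornerCol m W
  swap
  · have h1 := h.le_two_mul_card_leftExtra hcc
    have h2 := h.card_spikes_top_le J hJ hv hvs
    have h3 := h.card_spikes_bot_le J hJ hw hws
    omega
  have hcc' := hcc
  obtain ⟨hm, c1, c2, c3⟩ := hcc'
  set T := (Finset.Icc 2 (m / 2)).filter (fun r => nearDist {z | W 1 z} r = r - 1) with hT
  set B := (Finset.Icc 2 (m / 2)).filter (fun r => nearDist {z | W m z} r = r - 1) with hB
  have hE := h.corner_card_leftExtra hcc (T := T) (B := B)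
    (fun r h1 h2 h3 => by rw [hT, Finset.mem_filter, Finset.mem_Icc]; omega)
    (fun r h1 h2 h3 => by rw [hB, Finset.mem_filter, Finset.mem_Icc]; omega)
  have hTc : (T.card : ℤ) ≤ m / 2 - 1 := by
    have : T.card ≤ (Finset.Icc 2 (m / 2)).card := Finset.card_filter_le _ _
    rw [Int.card_Icc] at this
    omega
  have hBc : (B.card : ℤ) ≤ m / 2 - 1 := by
    have : B.card ≤ (Finset.Icc 2 (m / 2)).card := Finset.card_filter_le _ _
    rw [Int.card_Icc] at this
    omega
  have h2 := h.card_spikes_top_le J hJ hv hvs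
  have h3 := h.card_spikes_bot_le J hJ hw hws
  have hnt := nearDist_nonneg {z | W 1 z} 1
  have hnb := nearDist_nonneg {z | W m z} 1
  have hv1 := h.col_pos hv
  have hw1 := h.col_pos hw
  -- Where the diagonal follows the envelope, `leftExtra` loses rows, but the first row then has a
  -- long stretch without cells and so few peaks; both losses are bounded together.
  have hTS : 1 < v → 2 * (T.card : ℤ) +
      2 * ((J.filter (fun j => ¬ W (1 + nearDist {z | W 1 z} j) j)).card : ℤ) ≤ v - m % 2 := by
    intro hv1
    refine two_mul_card_add_card_peaks_le (A := {z | W 1 z}) (by omega) c1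
      (fun z hz => h.col_pos hz) hv hv1 _ _ ?_ ?_
    · intro s hs
      rw [Finset.mem_filter] at hs
      have hp := h.isPeak_top (hJ s hs.1).1 (hJ s hs.1).2 hs.2
      refine ⟨hp, hvs s hs.1 hp, fun h2s e => hs.2 ?_⟩
      rw [e, add_sub_cancel]
      exact (h.corner_diag hcc (hJ s hs.1).1 h2s).1
    · intro r hr
      rw [hT, Finset.mem_filter, Finset.mem_Icc] at hr
      omega
  have hBS : 1 < w → 2 * (B.card : ℤ) +
      2 * ((J.filter (fun j => ¬ W (m - nearDist {z | W m z} j) j)).card : ℤ) ≤ w - m % 2 := by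
    intro hw1
    refine two_mul_card_add_card_peaks_le (A := {z | W m z}) (by omega) c2
      (fun z hz => h.col_pos hz) hw hw1 _ _ ?_ ?_
    · intro s hs
      rw [Finset.mem_filter] at hs
      have hp := h.isPeak_bot (hJ s hs.1).1 (hJ s hs.1).2 hs.2
      refine ⟨hp, hws s hs.1 hp, fun h2s e => hs.2 ?_⟩
      rw [e, show m - (s - 1) = m + 1 - s by ring]
      exact (h.corner_diag hcc (hJ s hs.1).1 h2s).2
    · intro r hr
      rw [hB, Finset.mem_filter, Finset.mem_Icc] at hr
      omega
  have hor := hc hcc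
  by_cases hv2 : 1 < v <;> by_cases hw2 : 1 < w
  · have := hTS hv2
    have := hBS hw2
    omega
  · have := hTS hv2
    omega
  · have := hBS hw2
    omega
  · omega

theorem exists_pred_of_isProperCol (h : GridFort m n W) {p : ℤ} (hp : IsProperCol m W p)
    (hp1 : 1 < p) (hn2 : ¬ IsProperCol m W (p - 2)) :
    ∃ i, W i (p - 1) := by
  by_contra he
  push Not at he
  have hpn := h.col_le hp.2
  have := (h.isProperCol_empty_iff (e := p - 1) (by omega) (by omega) he).2 (by simpa using hp)
  rw [show p - 1 - 1 = p - 2 by ring] at this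
  exact hn2 this

/-- The columns before the first proper column. -/
theorem sum_left (h : GridFort m n W) {p : ℤ} (hp : IsProperCol m W p) (hp1 : 1 < p)
    (hn : ∀ j, 1 ≤ j → j < p → ¬ IsProperCol m W j) :
    m - 1 ≤ 2 * ∑ j ∈ Finset.Ico 1 p, (colCard m W j - 1) ∧
    (m - 2 ≤ ∑ j ∈ Finset.Ico 1 p, (colCard m W j - 1) ∨
      (IsCornerCol m W ∧ (∀ z, z ≤ p → W 1 z → z = 1) ∧ (∀ z, z ≤ p → W m z → z = 1) ∧
        p ≤ 2 + nearDist {z | W 1 z} p ∧ p ≤ 2 + nearDist {z | W m z} p)) := by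
  classical
  have hpn := h.col_le hp.2
  obtain ⟨i, hi⟩ := h.exists_pred_of_isProperCol hp hp1 (by
    intro h2
    exact hn _ (h.col_pos h2.2) (by omega) h2)
  obtain ⟨hlt, hlb⟩ := h.exists_left hp hi (hn _ (by omega) (by omega))
  obtain ⟨v, hv, hvp, hvd, hvd', hvmax, hvs⟩ := exists_last_mem hlt
  obtain ⟨w, hw, hwp, hwd, hwd', hwmax, hws⟩ := exists_last_mem hlb
  have hJ : ∀ j ∈ Finset.Ico 1 p, 1 ≤ j ∧ j ≤ n := by
    intro j hj
    rw [Finset.mem_Ico] at hj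
    omega
  have hJn : ∀ j ∈ Finset.Ico 1 p, ¬ IsProperCol m W j := by
    intro j hj
    rw [Finset.mem_Ico] at hj
    exact hn j hj.1 hj.2
  have hvs' : ∀ s ∈ Finset.Ico 1 p, IsPeak {z | W 1 z} s → s < v := by
    intro s hs
    exact hvs s (Finset.mem_Ico.1 hs).2
  have hws' : ∀ s ∈ Finset.Ico 1 p, IsPeak {z | W m z} s → s < w := by
    intro s hs
    exact hws s (Finset.mem_Ico.1 hs).2
  have f1 := h.first_top_le hv
  have f2 := h.first_bot_le hw
  have n1 := nearDist_nonneg {z | W 1 z} 1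
  have n2 := nearDist_nonneg {z | W m z} 1
  have hpe := hp.1
  have hS1 := h.card_spikes_top_le _ hJ hv hvs'
  have hS2 := h.card_spikes_bot_le _ hJ hw hws'
  rw [Finset.sum_sub_distrib]
  simp only [Finset.sum_const, Int.card_Ico, nsmul_eq_mul, mul_one]
  have c0 := h.two_mul_card_add_le_sum (Finset.Ico 1 p) hJn ∅ (by simp)
  have c1 := h.two_mul_card_add_le_sum (Finset.Ico 1 p) hJn (leftExtra m W) (by
    intro x hx
    obtain ⟨x1, x2, x3, x4⟩ := h.of_mem_leftExtra hx
    refine ⟨?_, x1, x2, x3⟩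
    have := h.col_pos x1
    -- Column `p` holds only its envelope cell, so no extra cell lies there.
    have hne : x.2 ≠ p := by
      intro e
      rw [e] at x1 x2
      exact x2 (h.eq_of_isProperCol hp x1)
    rw [Finset.mem_Ico]
    omega)
  rw [Int.card_Ico] at c0 c1
  simp only [Finset.card_empty] at c0
  push_cast at c0 c1
  have hp0 : (((p - 1).toNat : ℕ) : ℤ) = p - 1 := by omega
  rw [hp0] at c0 c1 ⊢
  refine ⟨by omega, ?_⟩
  -- The balance is unavailable only if neither outer row has a cell in columns `2, …, p`.
  by_cases hexc : IsCornerCol m W → 1 < v ∨ 1 < w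
  · left
    have := h.left_balance _ hJ hv hvs' hw hws' hexc
    omega
  · right
    push Not at hexc
    obtain ⟨e1, e2, e3⟩ := hexc
    refine ⟨e1, fun z hz hWz => ?_, fun z hz hWz => ?_, by omega, by omega⟩
    · have := hvmax z hWz hz
      have := h.col_pos hWz
      omega
    · have := hwmax z hWz hz
      have := h.col_pos hWz
      omega

end GridFort

/-! ### Reflection, and forts without proper columns -/

theorem isProperCol_flipCols {m n : ℤ} {W : ℤ → ℤ → Prop} {j : ℤ} :
    IsProperCol m (fun i j => W i (n + 1 - j)) j ↔ IsProperCol m W (n + 1 - j) := by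
  unfold IsProperCol
  have h1 := nearDist_reflect {z | W 1 z} (n + 1) j
  have h2 := nearDist_reflect {z | W m z} (n + 1) j
  change nearDist {z | W 1 (n + 1 - z)} j = _ at h1
  change nearDist {z | W m (n + 1 - z)} j = _ at h2
  rw [h1, h2]

theorem sum_reflect_Icc (n a b : ℤ) (f : ℤ → ℤ) :
    ∑ j ∈ Finset.Icc a b, f (n + 1 - j) = ∑ j ∈ Finset.Icc (n + 1 - b) (n + 1 - a), f j := by
  refine Finset.sum_nbij' (fun j => n + 1 - j) (fun j => n + 1 - j) ?_ ?_ ?_ ?_ ?_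
  · intro j hj; rw [Finset.mem_Icc] at hj ⊢; omega
  · intro j hj; rw [Finset.mem_Icc] at hj ⊢; omega
  · intro j _; ring
  · intro j _; ring
  · intro j _; rfl

namespace GridFort

variable {m n : ℤ} {W : ℤ → ℤ → Prop}

theorem two_le_colCard (h : GridFort m n W) {i i' j : ℤ} (hi : W i j) (hi' : W i' j)
    (hne : i ≠ i') : 2 ≤ colCard m W j := by
  classical
  have hs : ({i, i'} : Finset ℤ) ⊆ (Finset.Icc 1 m).filter (fun i => W i j) := by
    intro x hx
    rw [Finset.mem_insert, Finset.mem_singleton] at hx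
    rcases hx with rfl | rfl
    · simp [hi, h.row_pos hi, h.row_le hi]
    · simp [hi', h.row_pos hi', h.row_le hi']
  have := Finset.card_le_card hs
  rw [Finset.card_pair hne] at this
  unfold colCard
  omega

theorem isPeak_top_lt (h : GridFort m n W) {s : ℤ} (hs : IsPeak {z | W 1 z} s) :
    s < n - nearDist {z | W 1 z} n := by
  have h1 := nearDist_le_of_le (j := n) hs.2.2 (h.col_le (i := 1) hs.2.2)
  have := hs.one_le
  omega

theorem isPeak_bot_lt (h : GridFort m n W) {s : ℤ} (hs : IsPeak {z | W m z} s) :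
    s < n - nearDist {z | W m z} n := by
  have h1 := nearDist_le_of_le (j := n) hs.2.2 (h.col_le (i := m) hs.2.2)
  have := hs.one_le
  omega

theorem flip_nearDist_one (m n : ℤ) (W : ℤ → ℤ → Prop) :
    nearDist {z | W 1 (n + 1 - z)} 1 = nearDist {z | W 1 z} n ∧
    nearDist {z | W m (n + 1 - z)} 1 = nearDist {z | W m z} n := by
  have h1 := nearDist_reflect {z | W 1 z} (n + 1) 1
  have h2 := nearDist_reflect {z | W m z} (n + 1) 1
  rw [add_sub_cancel_right] at h1 h2
  exact ⟨h1, h2⟩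

theorem last_col (h : GridFort m n W) : W (1 + nearDist {z | W 1 z} n) n ∧
    W (m - nearDist {z | W m z} n) n ∧ W 1 (n - nearDist {z | W 1 z} n) ∧
    W m (n - nearDist {z | W m z} n) := by
  have := h.flipCols.first_col
  rw [(flip_nearDist_one m n W).1, (flip_nearDist_one m n W).2] at this
  rw [add_sub_cancel_right, add_comm n 1, add_sub_add_left_eq_sub, add_sub_add_left_eq_sub] at this
  exact this

/-- Each envelope is vacant in at most half of the columns, so on average a column keeps one of its
two cells. -/
theorem sum_nonneg_of_forall_not_isProperCol (h : GridFort m n W)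
    (hn : ∀ j, 1 ≤ j → j ≤ n → ¬ IsProperCol m W j) :
    0 ≤ ∑ j ∈ Finset.Icc 1 n, (colCard m W j - 1) := by
  classical
  have hJ : ∀ j ∈ Finset.Icc 1 n, 1 ≤ j ∧ j ≤ n := fun j hj => Finset.mem_Icc.1 hj
  obtain ⟨-, -, l1, l2⟩ := h.last_col
  have s1 := h.card_spikes_top_le _ hJ l1 fun s _ hs => h.isPeak_top_lt hs
  have s2 := h.card_spikes_bot_le _ hJ l2 fun s _ hs => h.isPeak_bot_lt hs
  have c0 := h.two_mul_card_add_le_sum (Finset.Icc 1 n)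
    (fun j hj => hn j (hJ j hj).1 (hJ j hj).2) ∅ (by simp)
  have n1 := nearDist_nonneg {z | W 1 z} 1
  have n2 := nearDist_nonneg {z | W m z} 1
  have n3 := nearDist_nonneg {z | W 1 z} n
  have n4 := nearDist_nonneg {z | W m z} n
  have := h.one_le_cols
  rw [Finset.sum_sub_distrib]
  simp only [Finset.sum_const, nsmul_eq_mul, mul_one, Int.card_Icc, Finset.card_empty] at c0 ⊢
  push_cast at c0
  omega

/-- Extra cells from both ends are counted; `m < n` keeps them apart. Only the right end must not be
a corner column, since `left_balance` copes with one on the left. -/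
theorem sum_of_not_isCornerCol (h : GridFort m n W) (hmn : m < n)
    (hn : ∀ j, 1 ≤ j → j ≤ n → ¬ IsProperCol m W j)
    (hc : ¬ IsCornerCol m (fun i j => W i (n + 1 - j))) :
    m - 2 ≤ ∑ j ∈ Finset.Icc 1 n, (colCard m W j - 1) := by
  classical
  have hJ : ∀ j ∈ Finset.Icc 1 n, 1 ≤ j ∧ j ≤ n := fun j hj => Finset.mem_Icc.1 hj
  obtain ⟨l3, l4, l1, l2⟩ := h.last_col
  obtain ⟨f3, f4, f1, f2⟩ := h.first_col
  have hr := h.flipCols.le_two_mul_card_leftExtra hc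
  rw [(flip_nearDist_one m n W).1, (flip_nearDist_one m n W).2] at hr
  have r1 := h.row_le l3
  have r2 := h.row_pos l4
  have r3 := h.row_le f3
  have r4 := h.row_pos f4
  have n1 := nearDist_nonneg {z | W 1 z} 1
  have n2 := nearDist_nonneg {z | W m z} 1
  have n3 := nearDist_nonneg {z | W 1 z} n
  have n4 := nearDist_nonneg {z | W m z} n
  have hb := h.left_balance (Finset.Icc 1 n) hJ l1 (fun s _ hs => h.isPeak_top_lt hs) l2
    (fun s _ hs => h.isPeak_bot_lt hs) (fun _ => Or.inl (by omega))
  set R := (leftExtra m (fun i j => W i (n + 1 - j))).image (fun x => (x.1, n + 1 - x.2)) with hR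
  have hRc : R.card = (leftExtra m (fun i j => W i (n + 1 - j))).card := by
    refine Finset.card_image_of_injective _ fun x y hxy => ?_
    have h1 := (Prod.ext_iff.1 hxy).1
    have h2 := (Prod.ext_iff.1 hxy).2
    simp only at h1 h2
    exact Prod.ext h1 (by omega)
  have hRm : ∀ x ∈ R, W x.1 x.2 ∧ x.1 ≠ 1 + nearDist {z | W 1 z} x.2 ∧
      x.1 ≠ m - nearDist {z | W m z} x.2 ∧ 2 * (n - x.2) ≤ m - 1 := by
    intro x hx
    obtain ⟨y, hy, rfl⟩ := Finset.mem_image.1 hx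
    obtain ⟨y1, y2, y3, y4⟩ := h.flipCols.of_mem_leftExtra hy
    rw [(flip_nearDist_one m n W).1, (flip_nearDist_one m n W).2] at y4
    have e1 := nearDist_reflect {z | W 1 z} (n + 1) y.2
    have e2 := nearDist_reflect {z | W m z} (n + 1) y.2
    change nearDist {z | W 1 (n + 1 - z)} y.2 = _ at e1
    change nearDist {z | W m (n + 1 - z)} y.2 = _ at e2
    rw [e1] at y2
    rw [e2] at y3
    refine ⟨y1, y2, y3, ?_⟩
    simp only
    omega
  have hd : Disjoint (leftExtra m W) R := by
    rw [Finset.disjoint_left]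
    intro x hx hx'
    have h1 := (h.of_mem_leftExtra hx).2.2.2
    have h2 := (hRm x hx').2.2.2
    omega
  have c0 := h.two_mul_card_add_le_sum (Finset.Icc 1 n)
    (fun j hj => hn j (hJ j hj).1 (hJ j hj).2) (leftExtra m W ∪ R) (by
      intro x hx
      have : W x.1 x.2 ∧ x.1 ≠ 1 + nearDist {z | W 1 z} x.2 ∧
          x.1 ≠ m - nearDist {z | W m z} x.2 := by
        rcases Finset.mem_union.1 hx with hx | hx
        · have := h.of_mem_leftExtra hx
          tauto
        · have := hRm x hx
          tauto
      exact ⟨Finset.mem_Icc.2 ⟨h.col_pos this.1, h.col_le this.1⟩, this⟩)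
  rw [Finset.card_union_of_disjoint hd, hRc] at c0
  rw [Finset.sum_sub_distrib]
  simp only [Finset.sum_const, nsmul_eq_mul, mul_one, Int.card_Icc] at c0 ⊢
  push_cast at c0
  omega

/-- Each of the first and last `m / 2` columns has two diagonal cells; the columns `K` in between
have excess at least `-1`, and at least `0` if their number is even. -/
theorem sum_of_isCornerCol (h : GridFort m n W) (hmn : m < n)
    (hn : ∀ j, 1 ≤ j → j ≤ n → ¬ IsProperCol m W j) (hl : IsCornerCol m W)
    (hr : IsCornerCol m (fun i j => W i (n + 1 - j))) :
    m - 2 ≤ ∑ j ∈ Finset.Icc 1 n, (colCard m W j - 1) := by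
  classical
  have hm := hl.1
  set K := Finset.Icc ((m + 2) / 2) (n + 1 - (m + 2) / 2) with hK
  have hKn : ∀ j ∈ K, 1 ≤ j ∧ j ≤ n := by
    intro j hj
    rw [hK, Finset.mem_Icc] at hj
    omega
  have c0 := h.two_mul_card_add_le_sum K (fun j hj => hn j (hKn j hj).1 (hKn j hj).2) ∅ (by simp)
  have s1 : 2 * ((K.filter (fun j => ¬ W (1 + nearDist {z | W 1 z} j) j)).card : ℤ) ≤
      (n + 2 - (m + 2) / 2) - ((m + 2) / 2 - 1) := by
    refine two_mul_card_peaks_le (Z := {z | W 1 z}) (by omega) _ fun s hs => ?_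
    obtain ⟨h1, h2⟩ := Finset.mem_filter.1 hs
    have h3 := h.isPeak_top (hKn s h1).1 (hKn s h1).2 h2
    rw [hK, Finset.mem_Icc] at h1
    exact ⟨h3, by omega, by omega⟩
  have s2 : 2 * ((K.filter (fun j => ¬ W (m - nearDist {z | W m z} j) j)).card : ℤ) ≤
      (n + 2 - (m + 2) / 2) - ((m + 2) / 2 - 1) := by
    refine two_mul_card_peaks_le (Z := {z | W m z}) (by omega) _ fun s hs => ?_
    obtain ⟨h1, h2⟩ := Finset.mem_filter.1 hs
    have h3 := h.isPeak_bot (hKn s h1).1 (hKn s h1).2 h2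
    rw [hK, Finset.mem_Icc] at h1
    exact ⟨h3, by omega, by omega⟩
  have hsub : K ⊆ Finset.Icc 1 n := fun j hj => Finset.mem_Icc.2 (hKn j hj)
  have hrest : ((Finset.Icc 1 n \ K).card : ℤ) ≤
      ∑ j ∈ Finset.Icc 1 n \ K, (colCard m W j - 1) := by
    have : ((Finset.Icc 1 n \ K).card : ℤ) = ∑ j ∈ Finset.Icc 1 n \ K, (1 : ℤ) := by simp
    rw [this]
    refine Finset.sum_le_sum fun j hj => ?_
    rw [Finset.mem_sdiff, hK, Finset.mem_Icc, Finset.mem_Icc] at hj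
    by_cases hjm : 2 * j ≤ m
    · have := h.corner_diag hl hj.1.1 hjm
      have := h.two_le_colCard this.1 this.2 (by omega)
      omega
    · have := h.flipCols.corner_diag hr (s := n + 1 - j) (by omega) (by omega)
      simp only [sub_sub_cancel] at this
      have := h.two_le_colCard this.1 this.2 (by omega)
      omega
  rw [← Finset.sum_sdiff hsub]
  rw [Finset.card_sdiff_of_subset hsub] at hrest
  have hcard := Finset.card_le_card hsub
  have hKs : ∑ j ∈ K, (colCard m W j - 1) = ∑ j ∈ K, colCard m W j - K.card := by
    rw [Finset.sum_sub_distrib]; simp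
  rw [Int.card_Icc] at hrest hcard
  have hKc : K.card = (n + 1 - (m + 2) / 2 + 1 - (m + 2) / 2).toNat := by rw [hK, Int.card_Icc]
  simp only [Finset.card_empty] at c0
  omega

/-- A fort without proper columns. -/
theorem sum_of_forall_not_isProperCol (h : GridFort m n W) (hmn : m < n)
    (hn : ∀ j, 1 ≤ j → j ≤ n → ¬ IsProperCol m W j) :
    m - 2 ≤ ∑ j ∈ Finset.Icc 1 n, (colCard m W j - 1) := by
  by_cases hr : IsCornerCol m (fun i j => W i (n + 1 - j))
  · by_cases hl : IsCornerCol m W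
    · exact h.sum_of_isCornerCol hmn hn hl hr
    · have := h.flipCols.sum_of_not_isCornerCol hmn
        (fun j h1 h2 => by
          rw [isProperCol_flipCols]
          exact hn _ (by omega) (by omega)) (by simpa only [sub_sub_cancel] using hl)
      have e := sum_reflect_Icc n 1 n (fun j => colCard m W j - 1)
      simp only [add_sub_cancel_left, add_sub_cancel_right] at e
      rw [← e]
      exact this
  · exact h.sum_of_not_isCornerCol hmn hn hr

end GridFort

/-! ### Lengths of zigzags -/

/-- At `e` the distance from `B` is `m - 1`. The next point of `B` is at `e + m - 1`, or at `e + m`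
if `e + 1` also lies in `A`; from there the argument repeats with `A` and `B` exchanged. -/
theorem zigzag_length_aux {m n : ℤ} (hm : 2 ≤ m) (k : ℕ) : ∀ (A B : Set ℤ) (e : ℤ), n - e ≤ k →
    e ∈ A → e ≤ n → (∀ z ∈ A, z ≤ n) → (∀ z ∈ B, z ≤ n) → B.Nonempty →
    (∀ j, e ≤ j → j ≤ n → nearDist A j + nearDist B j = m - 1) →
    ∃ q : ℤ, 0 ≤ q ∧ q * (m - 1) ≤ n - e ∧ n - e ≤ q * m := by
  induction k with
  | zero =>
    intro A B e hk he hen hA hB hBn hd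
    exact ⟨0, le_rfl, by simpa using hen, by push_cast at hk; simpa using hk⟩
  | succ k ih =>
    intro A B e hk he hen hA hB hBn hd
    rcases hen.eq_or_lt with rfl | hlt
    · exact ⟨0, le_rfl, by simp, by simp⟩
    have d0 := hd e le_rfl hen
    have d1 := hd (e + 1) (by omega) (by omega)
    rw [nearDist_eq_zero he] at d0
    have a1 := nearDist_le_of_le (j := e + 1) he (by omega)
    have a2 := nearDist_nonneg A (e + 1)
    have hd' : ∀ j, e ≤ j → j ≤ n → nearDist B j + nearDist A j = m - 1 := by
      intro j h1 h2; rw [add_comm]; exact hd j h1 h2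
    push_cast at hk
    have key : ∀ e' ∈ B, e + (m - 1) ≤ e' → e' ≤ e + m →
        ∃ q : ℤ, 0 ≤ q ∧ q * (m - 1) ≤ n - e ∧ n - e ≤ q * m := by
      intro e' he' h1 h2
      have hen' := hB e' he'
      obtain ⟨q, q0, q1, q2⟩ := ih B A e' (by omega) he' hen' hB hA ⟨e, he⟩
        (fun j hj hjn => hd' j (by omega) hjn)
      refine ⟨q + 1, by omega, ?_, ?_⟩
      · rw [add_mul, one_mul]; omega
      · rw [add_mul, one_mul]; omega
    rcases nearDist_mem hBn (e + 1) with hb | hb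
    · have := nearDist_le_iff (j := e) hb
      by_cases hm2 : nearDist B (e + 1) = 0
      · rw [hm2, sub_zero] at hb
        exact key _ hb (by omega) (by omega)
      · omega
    · exact key _ hb (by omega) (by omega)

theorem zigzag_length {m n e : ℤ} {A B : Set ℤ} (hm : 2 ≤ m) (he : e ∈ A) (hA : ∀ z ∈ A, z ≤ n)
    (hB : ∀ z ∈ B, z ≤ n) (hBn : B.Nonempty)
    (hd : ∀ j, e ≤ j → j ≤ n → nearDist A j + nearDist B j = m - 1) :
    ∃ q : ℤ, 0 ≤ q ∧ q * (m - 1) ≤ n - e ∧ n - e ≤ q * m := by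
  have := hA e he
  exact zigzag_length_aux hm (n - e).toNat A B e (by omega) he this hA hB hBn hd

/-! ### Forts without an empty column far from both ends -/

namespace GridFort

variable {m n : ℤ} {W : ℤ → ℤ → Prop}

theorem sum_Ico_split {a b c : ℤ} (f : ℤ → ℤ) (hab : a ≤ b) (hbc : b < c) :
    ∑ j ∈ Finset.Ico a c, f j = ∑ j ∈ Finset.Ico a b, f j + f b + ∑ j ∈ Finset.Ioo b c, f j := by
  rw [← Finset.Ico_union_Ico_eq_Ico hab hbc.le,
    Finset.sum_union (Finset.Ico_disjoint_Ico_consecutive a b c), ← Finset.Ioo_insert_left hbc,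
    Finset.sum_insert (by simp)]
  ring

theorem sum_Icc_split {a b c : ℤ} (f : ℤ → ℤ) (hab : a ≤ b) (hbc : b ≤ c) :
    ∑ j ∈ Finset.Icc a c, f j = ∑ j ∈ Finset.Ico a b, f j + f b + ∑ j ∈ Finset.Ioc b c, f j := by
  have e1 : Finset.Icc a c = Finset.Ico a (c + 1) := by ext; simp
  have e2 : Finset.Ioc b c = Finset.Ioo b (c + 1) := by ext; simp
  rw [e1, e2]
  exact sum_Ico_split f hab (by omega)

/-- Consecutive proper columns are adjacent, or separated by an empty column, or there are many cells
between them. -/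
theorem consecutive_cases (h : GridFort m n W) {a b : ℤ} (ha : IsProperCol m W a)
    (hb : IsProperCol m W b) (hab : a < b) (hn : ∀ j, a < j → j < b → ¬ IsProperCol m W j) :
    b = a + 1 ∨ (b = a + 2 ∧ ∀ i, ¬ W i (a + 1)) ∨
      m - 2 ≤ ∑ j ∈ Finset.Ioo a b, (colCard m W j - 1) := by
  have ha1 := h.col_pos ha.2
  have hbn := h.col_le hb.2
  by_cases h1 : b = a + 1
  · exact Or.inl h1
  right
  by_cases he : ∀ i, ¬ W i (a + 1)
  · left
    have := (h.isProperCol_empty_iff (e := a + 1) (by omega) (by omega) he).1 (by simpa using ha)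
    rw [show a + 1 + 1 = a + 2 by ring] at this
    refine ⟨?_, he⟩
    by_contra hne
    exact hn _ (by omega) (by omega) this
  · right
    push Not at he
    obtain ⟨i, hi⟩ := he
    have he' : ∃ i, W i (b - 1) := by
      by_contra he'
      push Not at he'
      have := (h.isProperCol_empty_iff (e := b - 1) (by omega) (by omega) he').2
        (by simpa using hb)
      rw [show b - 1 - 1 = b - 2 by ring] at this
      rcases eq_or_ne (b - 2) a with e | e
      · exact he' i (by convert hi using 1; omega)
      · exact hn _ (by omega) (by omega) this
    obtain ⟨i', hi'⟩ := he'
    exact h.sum_gap ha1 hbn (by omega) ha hb hn hi hi'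

/-- A proper column followed by an empty column, when no empty column is far from both ends. -/
theorem before_turn (h : GridFort m n W)
    (hs : ∀ e, m + 1 ≤ e → e + m ≤ n → ∃ i, W i e) {p : ℤ} (hp : IsProperCol m W p)
    (hpn : p + 1 ≤ n) (he : ∀ i, ¬ W i (p + 1)) :
    2 ≤ p ∧ 3 ≤ m ∧ ¬ IsProperCol m W (p - 1) ∧ ∃ i, W i (p - 1) := by
  have hp1 := h.col_pos hp.2
  have pt := h.isPeak_top (j := p + 1) (by omega) hpn (he _)
  have pb := h.isPeak_bot (j := p + 1) (by omega) hpn (he _)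
  have et := (nearDist_empty pt).1
  have eb := (nearDist_empty pb).1
  rw [add_sub_cancel_right] at et eb
  have hd := hp.1
  have nt := nearDist_nonneg {z | W 1 z} p
  have nb := nearDist_nonneg {z | W m z} p
  have tl : (1 : ℤ) ≤ _ := h.col_pos (i := 1) pt.2.1
  have tr : _ ≤ n := h.col_le (i := 1) pt.2.2
  have bl : (1 : ℤ) ≤ _ := h.col_pos (i := m) pb.2.1
  have br : _ ≤ n := h.col_le (i := m) pb.2.2
  -- Otherwise the last row is at distance `m` from column `p + 1` on both sides, so this empty
  -- column is far from both ends.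
  have ht0 : nearDist {z | W 1 z} p ≠ 0 := by
    intro e0
    obtain ⟨i, hi⟩ := hs (p + 1) (by omega) (by omega)
    exact he i hi
  have hb0 : nearDist {z | W m z} p ≠ 0 := by
    intro e0
    obtain ⟨i, hi⟩ := hs (p + 1) (by omega) (by omega)
    exact he i hi
  have dt := nearDist_le_of_le (j := p - 1) pt.2.1 (by omega)
  have db := nearDist_le_of_le (j := p - 1) pb.2.1 (by omega)
  refine ⟨by omega, by omega, fun hp' => by have := hp'.1; omega, ?_⟩
  by_contra hem
  push Not at hem
  have := (nearDist_empty (h.isPeak_top (j := p - 1) (by omega) (by omega) (hem _))).2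
  rw [sub_add_cancel] at this
  omega

/-- Induction along the proper columns. An empty column costs one, so the excess before it has to be
shown positive. -/
theorem sum_before_nonneg (h : GridFort m n W) (hm : 2 ≤ m)
    (hs : ∀ e, m + 1 ≤ e → e + m ≤ n → ∃ i, W i e) (k : ℕ) : ∀ p : ℤ, p ≤ k →
    IsProperCol m W p → 0 ≤ ∑ j ∈ Finset.Ico 1 p, (colCard m W j - 1) ∧
      (p + 1 ≤ n → (∀ i, ¬ W i (p + 1)) →
        1 ≤ ∑ j ∈ Finset.Ico 1 p, (colCard m W j - 1)) := by
  induction k with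
  | zero =>
    intro p hpk hp
    have := h.col_pos hp.2
    push_cast at hpk
    omega
  | succ k ih =>
    intro p hpk hp
    have hp1 := h.col_pos hp.2
    by_cases hpred : ∃ z, IsProperCol m W z ∧ z ≤ p - 1
    · obtain ⟨z, hz, hzp⟩ := hpred
      obtain ⟨a, ha, hap, -, hmax⟩ := exists_max_mem (A := {z | IsProperCol m W z}) hz hzp
      have ha1 := h.col_pos ha.2
      have hca := h.colCard_of_isProperCol ha
      obtain ⟨iha, iha'⟩ := ih a (by push_cast at hpk; omega) ha
      have hsum := sum_Ico_split (fun j => colCard m W j - 1) ha1 (show a < p by omega)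
      rcases h.consecutive_cases ha hp (by omega)
        (fun j h1 h2 hj => by have := hmax j hj (by omega); omega) with rfl | ⟨rfl, he⟩ | hgap
      · have e : Finset.Ioo a (a + 1) = ∅ := by ext; simp
        rw [e, Finset.sum_empty] at hsum
        refine ⟨by omega, fun hn he => ?_⟩
        obtain ⟨-, -, hnp, -⟩ := h.before_turn hs hp hn he
        rw [add_sub_cancel_right] at hnp
        exact absurd ha hnp
      · have e : Finset.Ioo a (a + 2) = {a + 1} := by ext; simp; omega
        have hpn := h.col_le hp.2
        rw [e, Finset.sum_singleton, colCard_of_empty he] at hsum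
        have := iha' (by omega) he
        refine ⟨by omega, fun hn he' => ?_⟩
        obtain ⟨-, -, -, i, hi⟩ := h.before_turn hs hp hn he'
        exact absurd (by convert hi using 1; ring) (he i)
      · refine ⟨by omega, fun hn he => ?_⟩
        obtain ⟨-, hm3, -, -⟩ := h.before_turn hs hp hn he
        omega
    · rcases hp1.eq_or_lt with rfl | hp1
      · refine ⟨by simp, fun hn he => ?_⟩
        have := h.before_turn hs hp hn he
        omega
      · have := (h.sum_left hp hp1 (fun j _ h2 hj => hpred ⟨j, hj, by omega⟩)).1
        exact ⟨by omega, fun _ _ => by omega⟩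

theorem sum_before (h : GridFort m n W) (hm : 2 ≤ m)
    (hs : ∀ e, m + 1 ≤ e → e + m ≤ n → ∃ i, W i e) {p : ℤ} (hp : IsProperCol m W p) :
    0 ≤ ∑ j ∈ Finset.Ico 1 p, (colCard m W j - 1) :=
  (h.sum_before_nonneg hm hs p.toNat p (by omega) hp).1

theorem sum_Ioc_flip (W : ℤ → ℤ → Prop) (p : ℤ) :
    ∑ j ∈ Finset.Ico 1 (n + 1 - p), (colCard m (fun i j => W i (n + 1 - j)) j - 1) =
      ∑ j ∈ Finset.Ioc p n, (colCard m W j - 1) := by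
  have e1 : Finset.Ico 1 (n + 1 - p) = Finset.Icc 1 (n - p) := by ext; simp; omega
  have e2 : Finset.Ioc p n = Finset.Icc (n + 1 - (n - p)) (n + 1 - 1) := by ext; simp; omega
  rw [e1, e2]
  exact sum_reflect_Icc n 1 (n - p) (fun j => colCard m W j - 1)

theorem flip_nonempty_far (hs : ∀ e, m + 1 ≤ e → e + m ≤ n → ∃ i, W i e) :
    ∀ e, m + 1 ≤ e → e + m ≤ n → ∃ i, W i (n + 1 - e) := fun e h1 h2 =>
  hs (n + 1 - e) (by omega) (by omega)

theorem sum_after (h : GridFort m n W) (hm : 2 ≤ m)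
    (hs : ∀ e, m + 1 ≤ e → e + m ≤ n → ∃ i, W i e) {p : ℤ} (hp : IsProperCol m W p) :
    0 ≤ ∑ j ∈ Finset.Ioc p n, (colCard m W j - 1) := by
  rw [← sum_Ioc_flip]
  exact h.flipCols.sum_before hm (flip_nonempty_far hs)
    (isProperCol_flipCols.2 (by simpa using hp))

theorem sum_nonneg (h : GridFort m n W) (hm : 2 ≤ m)
    (hs : ∀ e, m + 1 ≤ e → e + m ≤ n → ∃ i, W i e) :
    0 ≤ ∑ j ∈ Finset.Icc 1 n, (colCard m W j - 1) := by
  by_cases hp : ∃ p, IsProperCol m W p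
  · obtain ⟨p, hp⟩ := hp
    rw [sum_Icc_split _ (h.col_pos hp.2) (h.col_le hp.2), h.colCard_of_isProperCol hp]
    have := h.sum_before hm hs hp
    have := h.sum_after hm hs hp
    omega
  · exact h.sum_nonneg_of_forall_not_isProperCol fun j _ _ hj => hp ⟨j, hj⟩

theorem after_turn (h : GridFort m n W)
    (hs : ∀ e, m + 1 ≤ e → e + m ≤ n → ∃ i, W i e) {p : ℤ} (hp : IsProperCol m W p)
    (hp1 : 1 < p) (he : ∀ i, ¬ W i (p - 1)) :
    p + 1 ≤ n ∧ ¬ IsProperCol m W (p + 1) ∧ ∃ i, W i (p + 1) := by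
  have := h.flipCols.before_turn (flip_nonempty_far hs) (p := n + 1 - p)
    (isProperCol_flipCols.2 (by simpa using hp)) (by omega)
    (fun i hi => he i (by convert hi using 1; ring))
  rw [isProperCol_flipCols, show n + 1 - (n + 1 - p - 1) = p + 1 by ring] at this
  exact ⟨by omega, this.2.2.1, this.2.2.2⟩

end GridFort

namespace GridFort

variable {m n : ℤ} {W : ℤ → ℤ → Prop}

/-- The excess before `a` and after `b` is nonnegative. -/
theorem sum_of_gap (h : GridFort m n W) (hm : 2 ≤ m)
    (hs : ∀ e, m + 1 ≤ e → e + m ≤ n → ∃ i, W i e) {a b : ℤ} (ha : IsProperCol m W a)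
    (hb : IsProperCol m W b) (hab : a < b) :
    ∑ j ∈ Finset.Ioo a b, (colCard m W j - 1) ≤ ∑ j ∈ Finset.Icc 1 n, (colCard m W j - 1) := by
  have h1 := sum_Icc_split (fun j => colCard m W j - 1) (h.col_pos hb.2) (h.col_le hb.2)
  have h2 := sum_Ico_split (fun j => colCard m W j - 1) (h.col_pos ha.2) hab
  have := h.sum_before hm hs ha
  have := h.sum_after hm hs hb
  have := h.colCard_of_isProperCol ha
  have := h.colCard_of_isProperCol hb
  omega

theorem next_cases (h : GridFort m n W) (hm : 2 ≤ m)
    (hs : ∀ e, m + 1 ≤ e → e + m ≤ n → ∃ i, W i e)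
    (hD : ∑ j ∈ Finset.Icc 1 n, (colCard m W j - 1) < m - 2) {a b : ℤ} (ha : IsProperCol m W a)
    (hb : IsProperCol m W b) (hab : a < b) :
    IsProperCol m W (a + 1) ∨ (IsProperCol m W (a + 2) ∧ ∀ i, ¬ W i (a + 1)) := by
  obtain ⟨c, hc, hac, -, hmin⟩ :=
    exists_min_mem (A := {z | IsProperCol m W z}) hb (show a + 1 ≤ b by omega)
  rcases h.consecutive_cases ha hc (by omega)
    (fun j h1 h2 hj => by have := hmin j hj (by omega); omega) with rfl | ⟨rfl, he⟩ | hgap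
  · exact Or.inl hc
  · exact Or.inr ⟨hc, he⟩
  · have := h.sum_of_gap hm hs ha hc (by omega)
    omega

theorem pred_cases (h : GridFort m n W) (hm : 2 ≤ m)
    (hs : ∀ e, m + 1 ≤ e → e + m ≤ n → ∃ i, W i e)
    (hD : ∑ j ∈ Finset.Icc 1 n, (colCard m W j - 1) < m - 2) {a b : ℤ} (ha : IsProperCol m W a)
    (hb : IsProperCol m W b) (hab : a < b) :
    IsProperCol m W (b - 1) ∨ (IsProperCol m W (b - 2) ∧ ∀ i, ¬ W i (b - 1)) := by
  obtain ⟨c, hc, hcb, -, hmax⟩ :=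
    exists_max_mem (A := {z | IsProperCol m W z}) ha (show a ≤ b - 1 by omega)
  rcases h.consecutive_cases hc hb (by omega)
    (fun j h1 h2 hj => by have := hmax j hj (by omega); omega) with rfl | ⟨rfl, he⟩ | hgap
  · left; simpa using hc
  · right
    rw [show c + 2 - 1 = c + 1 by ring, add_sub_cancel_right]
    exact ⟨hc, he⟩
  · have := h.sum_of_gap hm hs hc hb (by omega)
    omega

theorem sum_right (h : GridFort m n W) {p : ℤ} (hp : IsProperCol m W p) (hpn : p < n)
    (hn : ∀ j, p < j → ¬ IsProperCol m W j) :
    m - 1 ≤ 2 * ∑ j ∈ Finset.Ioc p n, (colCard m W j - 1) := by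
  rw [← sum_Ioc_flip]
  exact (h.flipCols.sum_left (p := n + 1 - p) (isProperCol_flipCols.2 (by simpa using hp))
    (by omega) (fun j h1 h2 hj => hn _ (by omega) (isProperCol_flipCols.1 hj))).1

/-- If column `a + 1` were empty, its proper neighbours would border nonempty columns that are not
proper, hence be the first and the last proper columns. Two end stretches give excess `m - 1`, and
the empty column takes away only one. -/
theorem not_turn (h : GridFort m n W) (hm : 2 ≤ m)
    (hs : ∀ e, m + 1 ≤ e → e + m ≤ n → ∃ i, W i e)
    (hD : ∑ j ∈ Finset.Icc 1 n, (colCard m W j - 1) < m - 2) {a : ℤ} (ha : IsProperCol m W a)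
    (hb : IsProperCol m W (a + 2)) : ∃ i, W i (a + 1) := by
  by_contra he
  push Not at he
  have hbn := h.col_le hb.2
  obtain ⟨b1, -, b2, i, b3⟩ := h.before_turn hs ha (by omega) he
  obtain ⟨a1, a2, i', a3⟩ := h.after_turn hs hb (by omega)
    (by rwa [show a + 2 - 1 = a + 1 by ring])
  have hmin : ∀ j, 1 ≤ j → j < a → ¬ IsProperCol m W j := fun j _ hja hj => by
    rcases h.pred_cases hm hs hD hj ha hja with hc | ⟨-, hc⟩
    · exact b2 hc
    · exact hc _ b3
  have hmax : ∀ j, a + 2 < j → ¬ IsProperCol m W j := fun j hja hj => by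
    rcases h.next_cases hm hs hD hb hj hja with hc | ⟨-, hc⟩
    · exact a2 hc
    · exact hc _ a3
  have s1 := (h.sum_left ha (by omega) hmin).1
  have s2 := h.sum_right hb (by omega) hmax
  have h1 := sum_Icc_split (fun j => colCard m W j - 1) (h.col_pos hb.2) (h.col_le hb.2)
  have h2 := sum_Ico_split (fun j => colCard m W j - 1) (h.col_pos ha.2) (show a < a + 2 by omega)
  have e : Finset.Ioo a (a + 2) = {a + 1} := by ext; simp; omega
  rw [e, Finset.sum_singleton, colCard_of_empty he] at h2
  have := h.colCard_of_isProperCol ha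
  have := h.colCard_of_isProperCol hb
  omega

theorem isProperCol_add (h : GridFort m n W) (hm : 2 ≤ m)
    (hs : ∀ e, m + 1 ≤ e → e + m ≤ n → ∃ i, W i e)
    (hD : ∑ j ∈ Finset.Icc 1 n, (colCard m W j - 1) < m - 2) {a b : ℤ} (ha : IsProperCol m W a)
    (hb : IsProperCol m W b) (k : ℕ) (hk : a + k ≤ b) : IsProperCol m W (a + k) := by
  induction k with
  | zero => simpa using ha
  | succ k ih =>
    push_cast at hk ⊢
    rw [← add_assoc]
    rcases h.next_cases hm hs hD (ih (by omega)) hb (by omega) with hc | ⟨hc, he⟩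
    · exact hc
    · obtain ⟨i, hi⟩ := h.not_turn hm hs hD (ih (by omega)) hc
      exact absurd hi (he i)

/-- The single cell of the first column must be a corner, as otherwise both distances would drop in
column `2`. The set whose distance at `1` is `m - 1` then contains `m`. -/
theorem zigzag_of_top_corner {A B : Set ℤ} (hm : 3 ≤ m) (hmn : m < n) (hA : ∀ z ∈ A, 1 ≤ z)
    (hB : ∀ z ∈ B, 1 ≤ z) (hAn : A.Nonempty) (hBn : B.Nonempty)
    (hd : ∀ j, 1 ≤ j → j ≤ n → nearDist A j + nearDist B j = m - 1) : m ∈ A ∨ m ∈ B := by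
  have d1 := hd 1 le_rfl (by omega)
  have d2 := hd 2 (by omega) (by omega)
  have n1 := nearDist_nonneg A 1
  have n2 := nearDist_nonneg B 1
  have key : ∀ {Z : Set ℤ}, (∀ z ∈ Z, 1 ≤ z) → Z.Nonempty → 1 + nearDist Z 1 ∈ Z := by
    intro Z hZ hZn
    rcases nearDist_mem hZn 1 with hz | hz
    · have := hZ _ hz
      have := nearDist_nonneg Z 1
      have e : nearDist Z 1 = 0 := by omega
      rw [e] at hz ⊢
      simpa using hz
    · exact hz
  have kA := key hA hAn
  have kB := key hB hBn
  by_cases hA0 : nearDist A 1 = 0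
  · right
    convert kB using 1; omega
  · by_cases hB0 : nearDist B 1 = 0
    · left
      convert kA using 1; omega
    · have := nearDist_le_of_ge (j := 2) kA (by omega)
      have := nearDist_le_of_ge (j := 2) kB (by omega)
      omega

/-- Treats the exceptional alternative of `sum_left`. If `1` is still the point of one set nearest
to `p + 1`, the constant sum puts a point of the other set at `m`. If both nearest points are to the
right at positive distance, both distances drop at `p + 2`. -/
theorem corner_of_exceptional {A B : Set ℤ} {p : ℤ} (hm : 3 ≤ m) (hmn : m < n) (hp1 : 1 < p)
    (hpn : p ≤ n) (hA : ∀ z, z ≤ p → z ∈ A → z = 1) (hB : ∀ z, z ≤ p → z ∈ B → z = 1)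
    (h1A : 1 ∈ A) (h1B : 1 ∈ B) (hAn : ∀ z ∈ A, z ≤ n) (hA2 : p ≤ 2 + nearDist A p) (hB2 : p ≤ 2 + nearDist B p)
    (hd : ∀ j, p ≤ j → j ≤ n → nearDist A j + nearDist B j = m - 1) :
    p ≤ m ∧ (m ∈ A ∨ m ∈ B) := by
  have d0 := hd p le_rfl hpn
  have a0 := nearDist_le_of_le h1A hp1.le
  have b0 := nearDist_le_of_le h1B hp1.le
  have a1 := nearDist_le_of_le h1A (show 1 ≤ p + 1 by omega)
  have b1 := nearDist_le_of_le h1B (show 1 ≤ p + 1 by omega)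
  have na := nearDist_nonneg A (p + 1)
  have nb := nearDist_nonneg B (p + 1)
  have pA : 1 ≤ nearDist A p := nearDist_pos ⟨1, h1A⟩ fun hc => by
    have := hA p le_rfl hc; omega
  have pB : 1 ≤ nearDist B p := nearDist_pos ⟨1, h1B⟩ fun hc => by
    have := hB p le_rfl hc; omega
  have hpm : p ≤ m := by omega
  have d1 := hd (p + 1) (by omega) (by omega)
  refine ⟨hpm, ?_⟩
  have near : ∀ {Z : Set ℤ}, (∀ z, z ≤ p → z ∈ Z → z = 1) → 1 ∈ Z →
      nearDist Z (p + 1) = p ∨ p + 1 + nearDist Z (p + 1) ∈ Z := by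
    intro Z hZ h1
    have := nearDist_nonneg Z (p + 1)
    rcases nearDist_mem ⟨1, h1⟩ (p + 1) with hz | hz
    · by_cases h0 : nearDist Z (p + 1) = 0
      · rw [h0] at hz ⊢
        right; simpa using hz
      · left
        have := hZ _ (by omega) hz
        omega
    · exact Or.inr hz
  -- If `p + 1` lies in `Z`, the distances at `p` are `1` and `m - 2`; the latter is measured from
  -- `1`, so `p + 1 = m`.
  have far : ∀ {Z Y : Set ℤ}, (∀ z, z ≤ p → z ∈ Z → z = 1) → (∀ z, z ≤ p → z ∈ Y → z = 1) →
      1 ∈ Y → 1 ≤ nearDist Z p → 1 ≤ nearDist Y p → nearDist Z p + nearDist Y p = m - 1 →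
      nearDist Z (p + 1) + nearDist Y (p + 1) = m - 1 → p + 1 + nearDist Z (p + 1) ∈ Z →
      nearDist Z (p + 1) = 0 → m ∈ Z := by
    intro Z Y hZ hY h1 pZ pY e0 e1 hz h0
    have z0 := nearDist_le_of_ge (j := p) hz (by omega)
    rcases nearDist_mem ⟨1, h1⟩ p with hy | hy
    · have := hY _ (by omega) hy
      convert hz using 1
      omega
    · have := nearDist_le_of_ge (j := p + 1) hy (by omega)
      omega
  rcases near hA h1A with hA' | hA' <;> rcases near hB h1B with hB' | hB'
  · omega
  · right
    convert hB' using 1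
    omega
  · left
    convert hA' using 1
    omega
  · by_cases ea : nearDist A (p + 1) = 0
    · exact Or.inl (far hA hB h1B pA pB d0 d1 hA' ea)
    · by_cases eb : nearDist B (p + 1) = 0
      · exact Or.inr (far hB hA h1A pB pA (by omega) (by omega) hB' eb)
      · have := hAn _ hA'
        have d2 := hd (p + 2) (by omega) (by omega)
        have := nearDist_le_of_ge (j := p + 2) hA' (by omega)
        have := nearDist_le_of_ge (j := p + 2) hB' (by omega)
        omega

theorem zigzag_of_corner (h : GridFort m n W) (hm : 3 ≤ m)
    (hp : ∀ j, m ≤ j → j ≤ n → IsProperCol m W j) (hc : W 1 m ∨ W m m) :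
    ∃ q : ℤ, 0 ≤ q ∧ q * (m - 1) ≤ n - m ∧ n - m ≤ q * m := by
  rcases hc with hc | hc
  · exact zigzag_length (A := {z | W 1 z}) (B := {z | W m z}) (by omega) hc
      (fun z hz => h.col_le (i := 1) hz) (fun z hz => h.col_le (i := m) hz) h.bot_nonempty
      fun j h1 h2 => (hp j h1 h2).1
  · exact zigzag_length (A := {z | W m z}) (B := {z | W 1 z}) (by omega) hc
      (fun z hz => h.col_le (i := m) hz) (fun z hz => h.col_le (i := 1) hz) h.top_nonempty
      fun j h1 h2 => by rw [add_comm]; exact (hp j h1 h2).1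

theorem zigzag_of_proper (h : GridFort m n W) (hm : 3 ≤ m) (hmn : m < n) {p : ℤ} (hpn : p ≤ n)
    (hp : ∀ j, p ≤ j → j ≤ n → IsProperCol m W j) (hmin : ∀ j, j < p → ¬ IsProperCol m W j)
    (hsum : ∑ j ∈ Finset.Ico 1 p, (colCard m W j - 1) < m - 2) :
    ∃ q : ℤ, 0 ≤ q ∧ q * (m - 1) ≤ n - m ∧ n - m ≤ q * m := by
  have hpp := hp p le_rfl hpn
  rcases (h.col_pos hpp.2).eq_or_lt with rfl | hp1
  · exact h.zigzag_of_corner hm (fun j h1 h2 => hp j (by omega) h2)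
      (zigzag_of_top_corner hm hmn (fun z hz => h.col_pos (i := 1) hz)
        (fun z hz => h.col_pos (i := m) hz) h.top_nonempty h.bot_nonempty fun j h1 h2 => (hp j h1 h2).1)
  · rcases (h.sum_left hpp hp1 fun j _ h2 => hmin j h2).2 with hc | ⟨⟨-, c1, c2, -⟩, e1, e2, e3, e4⟩
    · omega
    · obtain ⟨f1, f2⟩ := corner_of_exceptional hm hmn hp1 hpn e1 e2 c1 c2
        (fun z hz => h.col_le (i := 1) hz) e3 e4
        fun j h1 h2 => (hp j h1 h2).1
      exact h.zigzag_of_corner hm (fun j h1 h2 => hp j (by omega) h2) f2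

/-- With excess below `m - 2` the proper columns form an interval. It reaches an end of the board,
and from its other end on the fort is a zigzag. -/
theorem sum_or_zigzag (h : GridFort m n W) (hm : 3 ≤ m) (hmn : m < n)
    (hs : ∀ e, m + 1 ≤ e → e + m ≤ n → ∃ i, W i e) :
    m - 2 ≤ ∑ j ∈ Finset.Icc 1 n, (colCard m W j - 1) ∨
      ∃ q : ℤ, 0 ≤ q ∧ q * (m - 1) ≤ n - m ∧ n - m ≤ q * m := by
  have hm2 : 2 ≤ m := by omega
  by_cases hex : ∃ p, IsProperCol m W p
  swap
  · exact Or.inl (h.sum_of_forall_not_isProperCol hmn fun j _ _ hj => hex ⟨j, hj⟩)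
  obtain ⟨z, hz⟩ := hex
  by_cases hD : m - 2 ≤ ∑ j ∈ Finset.Icc 1 n, (colCard m W j - 1)
  · exact Or.inl hD
  push Not at hD
  right
  obtain ⟨p, hp, -, hpz, hmin'⟩ :=
    exists_min_mem (A := {z | IsProperCol m W z}) hz (h.col_pos hz.2)
  obtain ⟨p', hp', -, hzp', hmax'⟩ :=
    exists_max_mem (A := {z | IsProperCol m W z}) hz (h.col_le hz.2)
  have hmin : ∀ j, j < p → ¬ IsProperCol m W j := fun j h1 hj => by
    have := hmin' j hj (h.col_pos hj.2); omega
  have hmax : ∀ j, p' < j → ¬ IsProperCol m W j := fun j h1 hj => by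
    have := hmax' j hj (h.col_le hj.2); omega
  have hall : ∀ j, p ≤ j → j ≤ p' → IsProperCol m W j := fun j h1 h2 => by
    have := h.isProperCol_add hm2 hs hD hp hp' (j - p).toNat (by omega)
    rwa [show p + ((j - p).toNat : ℤ) = j by omega] at this
  have hsplit := sum_Icc_split (fun j => colCard m W j - 1) (h.col_pos hp'.2) (h.col_le hp'.2)
  have hb' := h.sum_before hm2 hs hp
  have ha' := h.sum_after hm2 hs hp'
  have hc' := h.colCard_of_isProperCol hp'
  have hmid : ∑ j ∈ Finset.Ico 1 p', (colCard m W j - 1) =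
      ∑ j ∈ Finset.Ico 1 p, (colCard m W j - 1) := by
    rcases (show p ≤ p' by omega).eq_or_lt with rfl | hlt
    · rfl
    rw [sum_Ico_split _ (h.col_pos hp.2) hlt, h.colCard_of_isProperCol hp,
      Finset.sum_eq_zero (s := Finset.Ioo p p')]
    · ring
    · intro j hj
      rw [Finset.mem_Ioo] at hj
      rw [h.colCard_of_isProperCol (hall j hj.1.le hj.2.le), sub_self]
  rcases (h.col_le hp'.2).eq_or_lt with rfl | hpn
  · exact h.zigzag_of_proper hm hmn (by omega) hall hmin (by omega)
  rcases (h.col_pos hp.2).eq_or_lt with rfl | hp1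
  · refine h.flipCols.zigzag_of_proper hm hmn (p := n + 1 - p') (by omega)
      (fun j h1 h2 => isProperCol_flipCols.2 (hall _ (by omega) (by omega)))
      (fun j h1 hj => hmax _ (by omega) (isProperCol_flipCols.1 hj)) ?_
    rw [sum_Ioc_flip]
    omega
  -- Nonempty stretches at both ends would together have excess at least `m - 1`.
  · have := (h.sum_left hp hp1 fun j _ h2 => hmin j h2).1
    have := h.sum_right hp' hpn hmax
    omega

end GridFort

/-! ### Cutting at empty columns: the lower bound -/

namespace GridFort

variable {m n : ℤ} {W : ℤ → ℤ → Prop}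

/-- The part of a fort on one side of an empty column is a fort. -/
theorem left_part (h : GridFort m n W) {e : ℤ} (he1 : 1 < e) (hen : e ≤ n) (he : ∀ i, ¬ W i e) :
    GridFort m (e - 1) (fun i j => W i j ∧ j < e) where
  row_pos := fun hij => h.row_pos hij.1
  row_le := fun hij => h.row_le hij.1
  col_pos := fun hij => h.col_pos hij.1
  col_le := fun hij => by have := hij.2; omega
  nonempty := by
    -- Every fort meets the first column.
    obtain ⟨i, hi⟩ := h.transpose.top_nonempty
    exact ⟨i, 1, hi, he1⟩
  above := by
    intro i j i1 im j1 jn hij hW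
    rcases h.above i1 im j1 (by omega) (fun hc => hij ⟨hc, by omega⟩) hW.1 with hc | hc | hc
    · exact Or.inl ⟨hc, by omega⟩
    · exact Or.inr (Or.inl ⟨hc, by omega⟩)
    · refine Or.inr (Or.inr ⟨hc, ?_⟩)
      rcases (show j + 1 ≤ e by omega).eq_or_lt with hj | hj
      · rw [hj] at hc; exact absurd hc (he i)
      · exact hj
  below := by
    intro i j i1 im j1 jn hij hW
    rcases h.below i1 im j1 (by omega) (fun hc => hij ⟨hc, by omega⟩) hW.1 with hc | hc | hc
    · exact Or.inl ⟨hc, by omega⟩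
    · exact Or.inr (Or.inl ⟨hc, by omega⟩)
    · refine Or.inr (Or.inr ⟨hc, ?_⟩)
      rcases (show j + 1 ≤ e by omega).eq_or_lt with hj | hj
      · rw [hj] at hc; exact absurd hc (he i)
      · exact hj
  left := by
    intro i j i1 im j1 jn hij hW
    rcases h.left i1 im j1 (by omega) (fun hc => hij ⟨hc, by omega⟩) hW.1 with hc | hc | hc
    · exact Or.inl ⟨hc, by omega⟩
    · exact Or.inr (Or.inl ⟨hc, by omega⟩)
    · refine Or.inr (Or.inr ⟨hc, ?_⟩)
      rcases (show j + 1 ≤ e by omega).eq_or_lt with hj | hj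
      · rw [hj] at hc; exact absurd hc (he i)
      · exact hj
  right := by
    intro i j i1 im j1 jn hij hW
    rcases h.right i1 im j1 (by omega) (fun hc => hij ⟨hc, by omega⟩) hW.1 with hc | hc | hc
    · exact Or.inl ⟨hc, by omega⟩
    · exact Or.inr (Or.inl ⟨hc, by omega⟩)
    · exact Or.inr (Or.inr ⟨hc, by omega⟩)

theorem sum_left_part (m : ℤ) (W : ℤ → ℤ → Prop) (e : ℤ) :
    ∑ j ∈ Finset.Icc 1 (e - 1), colCard m (fun i j => W i j ∧ j < e) j =
      ∑ j ∈ Finset.Icc 1 (e - 1), colCard m W j := by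
  refine Finset.sum_congr rfl fun j hj => ?_
  rw [Finset.mem_Icc] at hj
  have hje : j < e := by omega
  unfold colCard
  congr 2
  ext i
  simp only [Finset.mem_filter, hje, and_true]

theorem sum_colCard_sub_one (m : ℤ) (W : ℤ → ℤ → Prop) (hn : 0 ≤ n) :
    ∑ j ∈ Finset.Icc 1 n, (colCard m W j - 1) = ∑ j ∈ Finset.Icc 1 n, colCard m W j - n := by
  rw [Finset.sum_sub_distrib]
  simp [hn]

theorem exists_ceil {m : ℤ} (hm : 2 ≤ m) {N : ℤ} (hN : 1 ≤ N) :
    ∃ Q r : ℤ, N = Q * (m + 1) - r ∧ 0 ≤ r ∧ r ≤ m ∧ 1 ≤ Q := by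
  have h1 := Int.emod_add_mul_ediv (N + m) (m + 1)
  have h2 := Int.emod_nonneg (N + m) (show m + 1 ≠ 0 by omega)
  have h3 := Int.emod_lt_of_pos (N + m) (show 0 < m + 1 by omega)
  refine ⟨(N + m) / (m + 1), m - (N + m) % (m + 1), by linarith, by omega, by omega, ?_⟩
  exact (Int.le_ediv_iff_mul_le (by omega)).2 (by omega)

/-- The lower bound for the number of cells `t` of a fort on a board with `N - 1` columns. -/
def SizeBound (m N t : ℤ) : Prop :=
  ∀ Q r : ℤ, N = Q * (m + 1) - r → 0 ≤ r → r ≤ m →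
    (r ≤ 2 * Q - 2 → 2 * (N - Q) + r ≤ 2 * t) ∧ (2 * Q - 2 < r → N - Q + m - 1 ≤ t)

/-- Either `r₁ + r₂ ≤ m` and the quotients add, or there is a carry: `Q` falls by one and `r` by `m
+ 1`. -/
theorem SizeBound.add {N₁ N₂ t₁ t₂ : ℤ} (hm : 2 ≤ m) (h₁ : SizeBound m N₁ t₁)
    (h₂ : SizeBound m N₂ t₂) (hN₁ : 1 ≤ N₁) (hN₂ : 1 ≤ N₂) : SizeBound m (N₁ + N₂) (t₁ + t₂) := by
  intro Q r hQ hr hrm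
  obtain ⟨Q₁, r₁, e₁, a₁, b₁, c₁⟩ := exists_ceil hm hN₁
  obtain ⟨Q₂, r₂, e₂, a₂, b₂, c₂⟩ := exists_ceil hm hN₂
  obtain ⟨f₁, g₁⟩ := h₁ Q₁ r₁ e₁ a₁ b₁
  obtain ⟨f₂, g₂⟩ := h₂ Q₂ r₂ e₂ a₂ b₂
  have key : (Q - (Q₁ + Q₂)) * (m + 1) = r - (r₁ + r₂) := by linarith
  have u : Q - (Q₁ + Q₂) < 1 := by
    by_contra hc
    have : (1 : ℤ) * (m + 1) ≤ (Q - (Q₁ + Q₂)) * (m + 1) :=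
      mul_le_mul_of_nonneg_right (by omega) (by omega)
    omega
  have l : -2 < Q - (Q₁ + Q₂) := by
    by_contra hc
    have : (Q - (Q₁ + Q₂)) * (m + 1) ≤ (-2) * (m + 1) :=
      mul_le_mul_of_nonneg_right (by omega) (by omega)
    omega
  rcases (show Q = Q₁ + Q₂ ∨ Q = Q₁ + Q₂ - 1 by omega) with rfl | rfl
  · have : r = r₁ + r₂ := by rw [sub_self, zero_mul] at key; omega
    constructor <;> intro <;> omega
  · have : r = r₁ + r₂ - (m + 1) := by
      rw [show Q₁ + Q₂ - 1 - (Q₁ + Q₂) = -1 by ring] at key; omega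
    constructor <;> intro <;> omega

theorem sizeBound_of_nonempty (h : GridFort m n W) (hm : 2 ≤ m) (hmn : m ≤ n)
    (hs : ∀ e, m + 1 ≤ e → e + m ≤ n → ∃ i, W i e) :
    SizeBound m (n + 1) (∑ j ∈ Finset.Icc 1 n, colCard m W j) := by
  intro Q r hQ hr hrm
  have hD := h.sum_nonneg hm hs
  have hsum := sum_colCard_sub_one (n := n) m W (by omega)
  -- Nonnegative excess means at least `n` cells, which suffices when `r ≤ 2 * Q - 2`.
  refine ⟨fun hrQ => by omega, fun hrQ => ?_⟩
  have Q1 : 1 ≤ Q := by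
    by_contra hc
    have : Q * (m + 1) ≤ 0 * (m + 1) := mul_le_mul_of_nonneg_right (by omega) (by omega)
    omega
  have Q2 : Q ≠ 1 := by
    rintro rfl
    omega
  have hQ2 : 2 * (m + 1) ≤ Q * (m + 1) := mul_le_mul_of_nonneg_right (by omega) (by omega)
  rcases h.sum_or_zigzag (by omega) (by omega) hs with hc | ⟨k, k0, k1, k2⟩
  · omega
  -- The upper estimate `n - m ≤ k * m` forces `k ≥ Q - 1`, whereas `r > 2 * Q - 2` means `n - m <
  -- (Q - 1) * (m - 1)`.
  · exfalso
    have hQk : Q ≤ k + 1 := by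
      by_contra hc
      have : (k + 2) * (m + 1) ≤ Q * (m + 1) := mul_le_mul_of_nonneg_right (by omega) (by omega)
      have e : (k + 2) * (m + 1) = k * m + k + 2 * m + 2 := by ring
      omega
    have e1 : Q * (m + 1) = Q * (m - 1) + 2 * Q := by ring
    have e2 : Q * (m - 1) ≤ (k + 1) * (m - 1) := mul_le_mul_of_nonneg_right hQk (by omega)
    rw [add_mul, one_mul] at e2
    omega

/-- Removing the empty column `e` leaves boards with `e - 1` and `n - e` columns, at least `m` each.
Numbers of columns increased by one add up, which is why the bound is stated for `n + 1`. -/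
theorem sizeBound_aux (hm : 2 ≤ m) (k : ℕ) : ∀ (n : ℤ) (W : ℤ → ℤ → Prop), n ≤ k → m ≤ n →
    GridFort m n W → SizeBound m (n + 1) (∑ j ∈ Finset.Icc 1 n, colCard m W j) := by
  induction k with
  | zero => intro n W h1 h2; push_cast at h1; omega
  | succ k ih =>
    intro n W hk hmn h
    push_cast at hk
    by_cases hs : ∀ e, m + 1 ≤ e → e + m ≤ n → ∃ i, W i e
    · exact h.sizeBound_of_nonempty hm hmn hs
    push Not at hs
    obtain ⟨e, e1, e2, he⟩ := hs
    have i1 := ih _ _ (by omega) (by omega) (h.left_part (by omega) (by omega) he)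
    have i2 := ih _ _ (by omega) (by omega)
      (h.flipCols.left_part (e := n + 1 - e) (by omega) (by omega)
        (fun i hi => he i (by convert hi using 1; ring)))
    rw [sum_left_part] at i1 i2
    have i3 := i1.add hm i2 (by omega) (by omega)
    convert i3 using 1
    · ring
    · have h1 := sum_Icc_split (fun j => colCard m W j) (show 1 ≤ e by omega)
        (show e ≤ n by omega)
      rw [colCard_of_empty he, add_zero] at h1
      rw [h1]
      have e3 : Finset.Icc 1 (e - 1) = Finset.Ico 1 e := by ext; simp
      have e4 : Finset.Ioc e n = Finset.Icc (n + 1 - (n + 1 - e - 1)) (n + 1 - 1) := by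
        ext; simp; omega
      rw [e3, e4]
      congr 1
      exact (sum_reflect_Icc n 1 (n + 1 - e - 1) (fun j => colCard m W j)).symm

theorem sizeBound (h : GridFort m n W) (hm : 2 ≤ m) (hmn : m ≤ n) :
    SizeBound m (n + 1) (∑ j ∈ Finset.Icc 1 n, colCard m W j) :=
  sizeBound_aux hm n.toNat n W (by omega) hmn h

end GridFort

/-! ### Constructions of small forts -/

theorem sum_ite_le {a b c d : ℤ} (hcd : c ≤ d + 1) :
    ∑ j ∈ Finset.Icc a b, (if c ≤ j ∧ j ≤ d then (1 : ℤ) else 0) ≤ d - c + 1 := by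
  rw [Finset.sum_boole]
  have : ((Finset.Icc a b).filter fun j => c ≤ j ∧ j ≤ d).card ≤ (Finset.Icc c d).card :=
    Finset.card_le_card fun j hj => by
      rw [Finset.mem_filter] at hj
      exact Finset.mem_Icc.2 hj.2
  rw [Int.card_Icc] at this
  omega

theorem colCard_le_card {m : ℤ} {W : ℤ → ℤ → Prop} {j : ℤ} (F : Finset ℤ)
    (hF : ∀ i, 1 ≤ i → i ≤ m → W i j → i ∈ F) : colCard m W j ≤ F.card := by
  classical
  unfold colCard
  refine Nat.cast_le.2 (Finset.card_le_card fun i hi => ?_)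
  rw [Finset.mem_filter, Finset.mem_Icc] at hi
  exact hF i hi.1.1 hi.1.2 hi.2

theorem colCard_congr {m : ℤ} {W W' : ℤ → ℤ → Prop} {j : ℤ} (h : ∀ i, W i j ↔ W' i j) :
    colCard m W j = colCard m W' j := by
  classical
  unfold colCard
  congr 2
  ext i
  simp only [Finset.mem_filter, h]

theorem colCard_flipRows (m : ℤ) (W : ℤ → ℤ → Prop) (j : ℤ) :
    colCard m (fun i j => W (m + 1 - i) j) j = colCard m W j := by
  classical
  unfold colCard
  congr 1
  refine Finset.card_nbij' (fun i => m + 1 - i) (fun i => m + 1 - i) ?_ ?_ ?_ ?_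
  · intro i hi
    simp only [Finset.coe_filter, Finset.mem_Icc, Set.mem_ofPred_eq] at hi ⊢
    exact ⟨by omega, hi.2⟩
  · intro i hi
    simp only [Finset.coe_filter, Finset.mem_Icc, Set.mem_ofPred_eq] at hi ⊢
    exact ⟨by omega, by simpa using hi.2⟩
  · intro i _; simp
  · intro i _; simp

/-- There is a fort with at most `t` cells whose last column consists of one corner of the board. -/
def HasCornerFort (m n t : ℤ) : Prop :=
  ∃ W, GridFort m n W ∧ (∀ i, W i n ↔ i = m) ∧ ∑ j ∈ Finset.Icc 1 n, colCard m W j ≤ t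

theorem HasCornerFort.of_top {m n t : ℤ} {W : ℤ → ℤ → Prop} (h : GridFort m n W)
    (h1 : ∀ i, W i n ↔ i = 1) (ht : ∑ j ∈ Finset.Icc 1 n, colCard m W j ≤ t) :
    HasCornerFort m n t := by
  refine ⟨_, h.flipRows, fun i => ?_, ?_⟩
  · rw [h1]; omega
  · simpa only [colCard_flipRows] using ht

theorem hasCornerFort_diag {m : ℤ} (hm : 1 ≤ m) : HasCornerFort m m m := by
  refine ⟨fun i j => i = j ∧ 1 ≤ i ∧ i ≤ m, ?_, fun i => by omega, ?_⟩
  · refine ⟨?_, ?_, ?_, ?_, ⟨1, 1, by omega⟩, ?_, ?_, ?_, ?_⟩ <;> intro i j <;> omega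
  · refine (Finset.sum_le_sum fun j _ => colCard_le_card {j} fun i _ _ hi => by simp [hi.1]).trans ?_
    simp
    omega

namespace GridFort

variable {m n : ℤ} {W : ℤ → ℤ → Prop}

/-- Continuing a fort that ends in a corner by a diagonal going to the opposite side. -/
theorem append_diag (h : GridFort m n W) (hlast : ∀ i, W i n ↔ i = m) (hm : 2 ≤ m) {s : ℤ}
    (hs0 : 0 ≤ s) (hs2 : s ≤ 2) :
    GridFort m (n + m - 1 + s)
      (fun i j => W i j ∨ (n < j ∧ 1 ≤ i ∧ i ≤ m ∧ i + j = m + n + s)) where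
  row_pos := fun hij => hij.elim h.row_pos fun hij => hij.2.1
  row_le := fun hij => hij.elim h.row_le fun hij => hij.2.2.1
  col_pos := fun hij => hij.elim h.col_pos fun hij => by
    have := h.col_pos ((hlast m).2 rfl); omega
  col_le := fun hij => hij.elim (fun hij => by have := h.col_le hij; omega) fun hij => by omega
  nonempty := ⟨m, n, Or.inl ((hlast m).2 rfl)⟩
  above := by
    intro i j i1 im j1 jn hij hW
    rw [not_or] at hij
    rcases le_or_gt j n with hj | hj
    · rcases h.above i1 im j1 hj hij.1 (hW.resolve_right (by omega)) with hc | hc | hc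
      · exact Or.inl (Or.inl hc)
      · exact Or.inr (Or.inl (Or.inl hc))
      · exact Or.inr (Or.inr (Or.inl hc))
    · have hN := hW.resolve_left fun hc => by have := h.col_le hc; omega
      by_cases hj1 : j = n + 1
      · right; left; left
        rw [hj1, add_sub_cancel_right, hlast]
        omega
      · exact Or.inr (Or.inl (Or.inr (by omega)))
  below := by
    intro i j i1 im j1 jn hij hW
    rw [not_or] at hij
    rcases le_or_gt j n with hj | hj
    · rcases h.below i1 im j1 hj hij.1 (hW.resolve_right (by omega)) with hc | hc | hc
      · exact Or.inl (Or.inl hc)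
      · exact Or.inr (Or.inl (Or.inl hc))
      · exact Or.inr (Or.inr (Or.inl hc))
    · have hN := hW.resolve_left fun hc => by have := h.col_le hc; omega
      exact Or.inr (Or.inr (Or.inr (by omega)))
  left := by
    intro i j i1 im j1 jn hij hW
    rw [not_or] at hij
    rcases le_or_gt j n with hj | hj
    · rcases h.left i1 im j1 hj hij.1 (hW.resolve_right (by omega)) with hc | hc | hc
      · exact Or.inl (Or.inl hc)
      · exact Or.inr (Or.inl (Or.inl hc))
      · exact Or.inr (Or.inr (Or.inl hc))
    · rcases hW with hW | hW
      · have hjn : j = n + 1 := by have := h.col_le hW; omega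
        rw [hjn, add_sub_cancel_right, hlast] at hW
        by_cases hs : s = 0
        · exact Or.inl (Or.inr (by omega))
        · exact Or.inr (Or.inr (Or.inr (by omega)))
      · exact Or.inl (Or.inr (by omega))
  right := by
    intro i j i1 im j1 jn hij hW
    rw [not_or] at hij
    rcases le_or_gt j n with hj | hj
    · rcases hW with hW | hW
      · rcases h.right i1 im j1 hj hij.1 hW with hc | hc | hc
        · exact Or.inl (Or.inl hc)
        · exact Or.inr (Or.inl (Or.inl hc))
        · exact Or.inr (Or.inr (Or.inl hc))
      · have hjn : j = n := by omega
        have h1 := hij.1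
        rw [hjn, hlast] at h1
        refine Or.inr (Or.inl (Or.inl ?_))
        rw [hjn, hlast]
        omega
    · have hN := hW.resolve_left fun hc => by have := h.col_le hc; omega
      by_cases him : i = m
      · refine Or.inr (Or.inr (Or.inl ?_))
        rw [show j - 1 = n by omega, hlast]
        exact him
      · exact Or.inr (Or.inl (Or.inr (by omega)))

end GridFort

/-- For `s = 0` the new diagonal starts at the old corner, for `s = 1` the corner is repeated in the
next column, for `s = 2` an empty column, counted by `a`, comes first. -/
theorem HasCornerFort.append {m n t : ℤ} (h : HasCornerFort m n t) (hm : 2 ≤ m) {s a : ℤ}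
    (hs0 : 0 ≤ s) (hs2 : s ≤ 2) (ha : (a = 0 ∧ s ≤ 1) ∨ (a = 1 ∧ s = 2)) :
    HasCornerFort m (n + m - 1 + s) (t + m - 1 + s - a) := by
  obtain ⟨W, h, hlast, ht⟩ := h
  have hn1 := h.col_pos ((hlast m).2 rfl)
  refine HasCornerFort.of_top (h.append_diag hlast hm hs0 hs2) (fun i => ?_) ?_
  · have : ¬ W i (n + m - 1 + s) := fun hc => by have := h.col_le hc; omega
    simp only [this, false_or]
    omega
  · have e : Finset.Icc 1 (n + m - 1 + s) = Finset.Icc 1 n ∪ Finset.Icc (n + 1) (n + m - 1 + s) := by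
      ext; simp; omega
    have hd : Disjoint (Finset.Icc 1 n) (Finset.Icc (n + 1) (n + m - 1 + s)) := by
      rw [Finset.disjoint_left]; intro x; simp; omega
    rw [e, Finset.sum_union hd]
    have s1 : ∑ j ∈ Finset.Icc 1 n, colCard m
        (fun i j => W i j ∨ (n < j ∧ 1 ≤ i ∧ i ≤ m ∧ i + j = m + n + s)) j =
        ∑ j ∈ Finset.Icc 1 n, colCard m W j := by
      refine Finset.sum_congr rfl fun j hj => colCard_congr fun i => ?_
      rw [Finset.mem_Icc] at hj
      exact or_iff_left (by omega)
    have s2 : ∑ j ∈ Finset.Icc (n + 1) (n + m - 1 + s), colCard m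
        (fun i j => W i j ∨ (n < j ∧ 1 ≤ i ∧ i ≤ m ∧ i + j = m + n + s)) j ≤
        (n + m - 1 + s) - (n + 1 + a) + 1 := by
      refine (Finset.sum_le_sum fun j hj => ?_).trans
        (sum_ite_le (a := n + 1) (b := n + m - 1 + s) (by omega))
      rw [Finset.mem_Icc] at hj
      have hW : ∀ i, ¬ W i j := fun i hc => by have := h.col_le hc; omega
      split_ifs with hc
      · exact colCard_le_card {m + n + s - j} fun i _ _ hi => by
          have := hi.resolve_left (hW i)
          rw [Finset.mem_singleton]; omega
      · exact colCard_le_card ∅ fun i _ _ hi => by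
          have := hi.resolve_left (hW i)
          omega
    omega

/-- A chain of `q` diagonals after the first one. -/
theorem hasCornerFort_zigzag {m : ℤ} (hm : 2 ≤ m) (q : ℕ) : ∀ r : ℤ, 0 ≤ r → r ≤ 2 * q →
    HasCornerFort m (m + q * (m + 1) - r) (m + q * m - r / 2) := by
  induction q with
  | zero =>
    intro r h0 hr
    obtain rfl : r = 0 := by push_cast at hr; omega
    simpa using hasCornerFort_diag (by omega)
  | succ q ih =>
    intro r h0 hr
    push_cast at hr
    -- Compared with `s = 2`, a diagonal with `s = 0` saves two columns and one cell, and one with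
    -- `s = 1` saves one column and no cell.
    rcases (show r = 0 ∨ r = 1 ∨ 2 ≤ r by omega) with rfl | rfl | h2
    · convert (ih 0 le_rfl (by omega)).append hm (s := 2) (a := 1) (by omega) (by omega) (by omega)
        using 1
      · push_cast; ring
      · push_cast; ring
    · convert (ih 0 le_rfl (by omega)).append hm (s := 1) (a := 0) (by omega) (by omega) (by omega)
        using 1
      · push_cast; ring
      · push_cast; norm_num; ring
    · convert (ih (r - 2) (by omega) (by omega)).append hm (s := 0) (a := 0) (by omega) (by omega)
        (by omega) using 1
      · push_cast; ring
      · rw [show (r - 2) / 2 = r / 2 - 1 by omega]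
        push_cast; ring

theorem HasCornerFort.append_turns {m n t : ℤ} (h : HasCornerFort m n t) (hm : 2 ≤ m) (q : ℕ) :
    HasCornerFort m (n + q * (m + 1)) (t + q * m) := by
  induction q with
  | zero => simpa using h
  | succ q ih =>
    convert ih.append hm (s := 2) (a := 1) (by omega) (by omega) (by omega) using 1
    · push_cast; ring
    · push_cast; ring

/-- The union of four segments: a diagonal reflected at the corner `(m, m)`, and two shorter
segments joining its two parts by way of the first row. -/
def FourSegments (m t i j : ℤ) : Prop :=
  1 ≤ i ∧ i ≤ m ∧ 1 ≤ j ∧ j ≤ m + t ∧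
    (i = j ∨ (i + j = 2 * m ∧ m ≤ j) ∨ j = i + 2 * t ∨ (i + j = 2 * t + 2 ∧ i ≤ j))

theorem gridFort_fourSegments {m t : ℤ} (ht : 1 ≤ t) (htm : t ≤ m - 2) :
    GridFort m (m + t) (FourSegments m t) := by
  refine ⟨?_, ?_, ?_, ?_, ⟨1, 1, ?_⟩, ?_, ?_, ?_, ?_⟩
  · intro i j h; exact h.1
  · intro i j h; exact h.2.1
  · intro i j h; exact h.2.2.1
  · intro i j h; exact h.2.2.2.1
  · unfold FourSegments; omega
  all_goals
    intro i j i1 im j1 jn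
    unfold FourSegments
    intro h1 h2
    rcases h2 with ⟨-, -, -, -, h2 | h2 | h2 | h2⟩ <;> omega

/-- The reflected diagonal has one cell in each of the `m + t` columns; the two shorter segments add
at most one in each of the columns `t + 2, …, m + t - 1`, since they meet it at both ends. -/
theorem hasCornerFort_core {m t : ℤ} (ht : 1 ≤ t) (htm : t ≤ m - 2) :
    HasCornerFort m (m + t) (2 * m + t - 2) := by
  refine HasCornerFort.of_top (gridFort_fourSegments ht htm).flipCols (fun i => ?_) ?_
  · unfold FourSegments; omega
  · have := sum_reflect_Icc (m + t) 1 (m + t) (fun j => colCard m (FourSegments m t) j)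
    rw [add_sub_cancel_right, add_sub_cancel_left] at this
    refine (le_of_eq this).trans ?_
    have hle : ∀ j ∈ Finset.Icc 1 (m + t), colCard m (FourSegments m t) j ≤
        1 + (if t + 2 ≤ j ∧ j ≤ m + t - 1 then (1 : ℤ) else 0) := by
      intro j hj
      split_ifs with hc
      · refine (colCard_le_card {if j ≤ m then j else 2 * m - j,
          if j ≤ 2 * t then 2 * t + 2 - j else j - 2 * t} fun i _ _ hi => ?_).trans ?_
        · rw [Finset.mem_insert, Finset.mem_singleton]
          unfold FourSegments at hi
          split_ifs <;> omega
        · exact_mod_cast Finset.card_le_two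
      · refine (colCard_le_card {if j ≤ m then j else 2 * m - j} fun i _ _ hi => ?_).trans ?_
        · rw [Finset.mem_singleton]
          unfold FourSegments at hi
          split_ifs <;> omega
        · simp
    refine (Finset.sum_le_sum hle).trans ?_
    rw [Finset.sum_add_distrib]
    have := sum_ite_le (a := 1) (b := m + t) (show t + 2 ≤ m + t - 1 + 1 by omega)
    have e : ∑ j ∈ Finset.Icc 1 (m + t), (1 : ℤ) = m + t := by simp; omega
    rw [e]
    omega

/-! ### Zero blocking sets and forts, and the passage to the grid graph -/

namespace SimpleGraph

variable {V : Type*} {G : SimpleGraph V}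

/-- A fort: a nonempty set of vertices such that no vertex outside has exactly one neighbour in
it. -/
def IsFort (G : SimpleGraph V) (F : Set V) : Prop :=
  F.Nonempty ∧ ∀ u, u ∉ F → ∀ v, v ∈ F → G.Adj u v → ∃ w, w ∈ F ∧ G.Adj u w ∧ w ≠ v

/-- The first force into a white fort would come from a vertex outside with only one neighbour in
it. -/
theorem IsFort.isZeroBlockingSet {F : Set V} (hF : G.IsFort F) : G.IsZeroBlockingSet F := by
  intro hz
  have key : ∀ v, G.ZeroForced Fᶜ v → v ∉ F := by
    intro v hv
    induction hv with
    | init v hv => exact hv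
    | force u v _ huv _ ihu ihw =>
      intro hvF
      obtain ⟨w, hw, huw, hwv⟩ := hF.2 u ihu v hvF huv
      exact ihw w huw hwv hw
  obtain ⟨v, hv⟩ := hF.1
  exact key v (hz v) hv

/-- The vertices that stay white for ever form a fort. -/
theorem IsZeroBlockingSet.exists_isFort {W : Set V} (hW : G.IsZeroBlockingSet W) :
    ∃ F, F ⊆ W ∧ G.IsFort F := by
  refine ⟨{v | ¬ G.ZeroForced Wᶜ v}, fun v hv => ?_, ?_, fun u hu v hv huv => ?_⟩
  · by_contra hvW
    exact hv (ZeroForced.init v hvW)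
  · by_contra hne
    refine hW fun v => ?_
    by_contra hv
    exact hne ⟨v, hv⟩
  · by_contra hc
    push Not at hc
    refine hv (ZeroForced.force u v (not_not.1 hu) huv fun w huw hwv => ?_)
    by_contra hw
    exact hwv (hc w hw huw)

end SimpleGraph

theorem gridGraph_adj {m n : ℕ} {x y : Fin m × Fin n} : (gridGraph m n).Adj x y ↔
    (((x.1 : ℕ) + 1 = y.1 ∨ (y.1 : ℕ) + 1 = x.1) ∧ x.2 = y.2) ∨
      (((x.2 : ℕ) + 1 = y.2 ∨ (y.2 : ℕ) + 1 = x.2) ∧ x.1 = y.1) := by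
  rw [gridGraph, SimpleGraph.boxProd_adj, SimpleGraph.pathGraph_adj, SimpleGraph.pathGraph_adj]

/-- The set of coordinates of the cells of `F`, with rows and columns numbered from one. -/
def cellsOf {m n : ℕ} (F : Set (Fin m × Fin n)) (i j : ℤ) : Prop :=
  ∃ x ∈ F, (x.1 : ℤ) + 1 = i ∧ (x.2 : ℤ) + 1 = j

theorem mem_iff_cellsOf {m n : ℕ} (F : Set (Fin m × Fin n)) (x : Fin m × Fin n) :
    x ∈ F ↔ cellsOf F ((x.1 : ℤ) + 1) ((x.2 : ℤ) + 1) := by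
  refine ⟨fun hx => ⟨x, hx, rfl, rfl⟩, ?_⟩
  rintro ⟨y, hy, h1, h2⟩
  have : y = x := Prod.ext (Fin.ext (by omega)) (Fin.ext (by omega))
  rwa [← this]

theorem exists_cell (m n : ℕ) {i j : ℤ} (i1 : 1 ≤ i) (im : i ≤ m) (j1 : 1 ≤ j) (jn : j ≤ n) :
    ∃ x : Fin m × Fin n, (x.1 : ℤ) + 1 = i ∧ (x.2 : ℤ) + 1 = j :=
  ⟨(⟨(i - 1).toNat, by omega⟩, ⟨(j - 1).toNat, by omega⟩), by simp; omega, by simp; omega⟩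

theorem sum_colCard_eq_card {m n : ℕ} {W : ℤ → ℤ → Prop} (F : Finset (Fin m × Fin n))
    (hF : ∀ x, x ∈ F ↔ W ((x.1 : ℤ) + 1) ((x.2 : ℤ) + 1)) :
    ∑ j ∈ Finset.Icc 1 (n : ℤ), colCard m W j = F.card := by
  classical
  rw [Finset.card_eq_sum_card_fiberwise (f := fun x : Fin m × Fin n => (x.2 : ℤ) + 1)
    (t := Finset.Icc 1 (n : ℤ)) (fun x _ => by simp)]
  push_cast
  refine Finset.sum_congr rfl fun j hj => ?_
  rw [Finset.mem_Icc] at hj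
  unfold colCard
  congr 1
  symm
  refine Finset.card_bij (fun x _ => (x.1 : ℤ) + 1) ?_ ?_ ?_
  · intro x hx
    rw [Finset.mem_filter] at hx
    have := (hF x).1 hx.1
    rw [hx.2] at this
    rw [Finset.mem_filter, Finset.mem_Icc]
    exact ⟨by omega, this⟩
  · intro x hx y hy hxy
    rw [Finset.mem_filter] at hx hy
    exact Prod.ext (Fin.ext (by omega)) (Fin.ext (by omega))
  · intro i hi
    rw [Finset.mem_filter, Finset.mem_Icc] at hi
    obtain ⟨x, rfl, rfl⟩ := exists_cell m n hi.1.1 hi.1.2 hj.1 hj.2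
    exact ⟨x, Finset.mem_filter.2 ⟨(hF x).2 hi.2, rfl⟩, rfl⟩

theorem gridFort_cellsOf {m n : ℕ} {F : Set (Fin m × Fin n)} (hF : (gridGraph m n).IsFort F) :
    GridFort m n (cellsOf F) := by
  have key : ∀ {i j i' j' : ℤ}, 1 ≤ i → i ≤ m → 1 ≤ j → j ≤ n → ¬ cellsOf F i j →
      cellsOf F i' j' → (((i + 1 = i' ∨ i' + 1 = i) ∧ j = j') ∨
        ((j + 1 = j' ∨ j' + 1 = j) ∧ i = i')) →
      ∃ k l, cellsOf F k l ∧ (k ≠ i' ∨ l ≠ j') ∧ (((i + 1 = k ∨ k + 1 = i) ∧ j = l) ∨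
        ((j + 1 = l ∨ l + 1 = j) ∧ i = k)) := by
    intro i j i' j' i1 im j1 jn hij hij' hadj
    obtain ⟨u, rfl, rfl⟩ := exists_cell m n i1 im j1 jn
    obtain ⟨v, hv, rfl, rfl⟩ := hij'
    obtain ⟨w, hw, huw, hwv⟩ := hF.2 u (fun hu => hij ((mem_iff_cellsOf F u).1 hu)) v hv
      (gridGraph_adj.2 (by simp only [Fin.ext_iff]; omega))
    refine ⟨_, _, (mem_iff_cellsOf F w).1 hw, ?_, ?_⟩
    · by_contra hc
      exact hwv (Prod.ext (Fin.ext (by omega)) (Fin.ext (by omega)))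
    · have := gridGraph_adj.1 huw
      simp only [Fin.ext_iff] at this
      omega
  refine ⟨?_, ?_, ?_, ?_, ?_, ?_, ?_, ?_, ?_⟩
  · rintro i j ⟨x, -, rfl, rfl⟩; omega
  · rintro i j ⟨x, -, rfl, rfl⟩; omega
  · rintro i j ⟨x, -, rfl, rfl⟩; omega
  · rintro i j ⟨x, -, rfl, rfl⟩; omega
  · obtain ⟨x, hx⟩ := hF.1
    exact ⟨_, _, (mem_iff_cellsOf F x).1 hx⟩
  all_goals
    intro i j i1 im j1 jn hij hW
    obtain ⟨k, l, hkl, hne, hadj⟩ := key i1 im j1 jn hij hW (by omega)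
    have e : (k = i - 1 ∧ l = j) ∨ (k = i + 1 ∧ l = j) ∨ (k = i ∧ l = j - 1) ∨
      (k = i ∧ l = j + 1) := by omega
    rcases e with ⟨rfl, rfl⟩ | ⟨rfl, rfl⟩ | ⟨rfl, rfl⟩ | ⟨rfl, rfl⟩ <;>
      first
        | exact Or.inl hkl
        | exact Or.inr (Or.inl hkl)
        | exact Or.inr (Or.inr hkl)
        | omega

theorem GridFort.isFort {m n : ℕ} {W : ℤ → ℤ → Prop} (h : GridFort m n W) :
    (gridGraph m n).IsFort {x | W ((x.1 : ℤ) + 1) ((x.2 : ℤ) + 1)} := by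
  have cell : ∀ {i j}, W i j → ∃ x : Fin m × Fin n, (x.1 : ℤ) + 1 = i ∧ (x.2 : ℤ) + 1 = j :=
    fun hij => exists_cell m n (h.row_pos hij) (h.row_le hij) (h.col_pos hij) (h.col_le hij)
  constructor
  · obtain ⟨i, j, hij⟩ := h.nonempty
    obtain ⟨x, rfl, rfl⟩ := cell hij
    exact ⟨x, hij⟩
  · intro u hu v hv huv
    have found : ∀ {i j}, W i j → ((((u.1 : ℤ) + 1 + 1 = i ∨ i + 1 = (u.1 : ℤ) + 1) ∧
        (u.2 : ℤ) + 1 = j) ∨ (((u.2 : ℤ) + 1 + 1 = j ∨ j + 1 = (u.2 : ℤ) + 1) ∧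
        (u.1 : ℤ) + 1 = i)) → (i ≠ (v.1 : ℤ) + 1 ∨ j ≠ (v.2 : ℤ) + 1) →
        ∃ w, W ((w.1 : ℤ) + 1) ((w.2 : ℤ) + 1) ∧ (gridGraph m n).Adj u w ∧ w ≠ v := by
      intro i j hij hadj hne
      obtain ⟨w, rfl, rfl⟩ := cell hij
      refine ⟨w, hij, gridGraph_adj.2 (by simp only [Fin.ext_iff]; omega), ?_⟩
      rintro rfl
      omega
    have u1 : (1 : ℤ) ≤ (u.1 : ℤ) + 1 := by omega
    have u2 : (u.1 : ℤ) + 1 ≤ m := by omega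
    have u3 : (1 : ℤ) ≤ (u.2 : ℤ) + 1 := by omega
    have u4 : (u.2 : ℤ) + 1 ≤ n := by omega
    have hv' : W ((v.1 : ℤ) + 1) ((v.2 : ℤ) + 1) := hv
    have hadj := gridGraph_adj.1 huv
    simp only [Fin.ext_iff] at hadj
    rcases hadj with ⟨e1 | e1, e2⟩ | ⟨e1 | e1, e2⟩
    · rcases h.below u1 u2 u3 u4 hu (by convert hv' using 1 <;> omega) with hc | hc | hc <;>
        exact found hc (by omega) (by omega)
    · rcases h.above u1 u2 u3 u4 hu (by convert hv' using 1 <;> omega) with hc | hc | hc <;>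
        exact found hc (by omega) (by omega)
    · rcases h.right u1 u2 u3 u4 hu (by convert hv' using 1 <;> omega) with hc | hc | hc <;>
        exact found hc (by omega) (by omega)
    · rcases h.left u1 u2 u3 u4 hu (by convert hv' using 1 <;> omega) with hc | hc | hc <;>
        exact found hc (by omega) (by omega)

/-! ### The zero blocking number of the grid -/

theorem zeroBlockingNumber_gridGraph_le {m n : ℕ} {t : ℤ} (h : HasCornerFort m n t) :
    ((gridGraph m n).zeroBlockingNumber : ℤ) ≤ t := by
  classical
  obtain ⟨W, h, -, ht⟩ := h
  refine le_trans ?_ ht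
  rw [sum_colCard_eq_card
    (Finset.univ.filter fun x : Fin m × Fin n => W ((x.1 : ℤ) + 1) ((x.2 : ℤ) + 1)) (by simp)]
  refine Nat.cast_le.2 (Nat.sInf_le ⟨_, ?_, rfl⟩)
  rw [Finset.coe_filter]
  simpa using h.isFort.isZeroBlockingSet

theorem sizeBound_zeroBlockingNumber {m n : ℕ} (hm : 2 ≤ m) (hmn : m ≤ n) :
    GridFort.SizeBound m ((n : ℤ) + 1) ((gridGraph m n).zeroBlockingNumber) := by
  classical
  have : Nonempty (Fin m × Fin n) := ⟨(⟨0, by omega⟩, ⟨0, by omega⟩)⟩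
  obtain ⟨S, hS, hcard⟩ := (gridGraph m n).isLeast_zeroBlockingNumber.1
  obtain ⟨F, hFS, hF⟩ := hS.exists_isFort
  have hb := (gridFort_cellsOf hF).sizeBound (by omega) (by omega)
  rw [sum_colCard_eq_card (Finset.univ.filter (· ∈ F))
    (by simpa using mem_iff_cellsOf F)] at hb
  have hle : (Finset.univ.filter (· ∈ F)).card ≤ S.card :=
    Finset.card_le_card fun x hx => hFS (by simpa using hx)
  intro Q r hQ hr hrm
  obtain ⟨b1, b2⟩ := hb Q r hQ hr hrm
  constructor <;> intro <;> omega

theorem theorem9 (m n : ℕ) (hm : 2 ≤ m) (hmn : m ≤ n) (q r : ℤ)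
    (hqr : (n : ℤ) - (m : ℤ) = q * ((m : ℤ) + 1) - r) (hr0 : 0 ≤ r) (hrm : r ≤ (m : ℤ)) :
    (r ≤ 2 * q →
      ((gridGraph m n).zeroBlockingNumber : ℤ) = (n : ℤ) - q + ⌈(r : ℚ) / 2⌉) ∧
    (2 * q < r →
      ((gridGraph m n).zeroBlockingNumber : ℤ) = (n : ℤ) - q + (m : ℤ) - 1) := by
  -- Adding `m + 1` to both sides gives `n + 1 = (q + 1) * (m + 1) - r`, so `Q = q + 1`.
  obtain ⟨l1, l2⟩ := sizeBound_zeroBlockingNumber hm hmn (q + 1) r (by linarith) hr0 hrm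
  have hq : 0 ≤ q := by
    by_contra hc
    have : q * ((m : ℤ) + 1) ≤ (-1) * ((m : ℤ) + 1) :=
      mul_le_mul_of_nonneg_right (by omega) (by omega)
    omega
  lift q to ℕ using hq
  have hexp : (q : ℤ) * ((m : ℤ) + 1) = q * m + q := by ring
  refine ⟨fun hrq => ?_, fun hrq => ?_⟩
  · have hceil : ⌈(r : ℚ) / 2⌉ = (r + 1) / 2 := by
      rw [Int.ceil_eq_iff]
      have h1 : 2 * ((r + 1) / 2) ≤ r + 1 := by omega
      have h2 : r ≤ 2 * ((r + 1) / 2) := by omega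
      have h1' : (2 : ℚ) * (((r + 1) / 2 : ℤ) : ℚ) ≤ r + 1 := by exact_mod_cast h1
      have h2' : (r : ℚ) ≤ 2 * (((r + 1) / 2 : ℤ) : ℚ) := by exact_mod_cast h2
      constructor <;> linarith
    have hu := hasCornerFort_zigzag (m := m) (by omega) q r hr0 hrq
    rw [show (m : ℤ) + q * (m + 1) - r = n by linarith] at hu
    have := zeroBlockingNumber_gridGraph_le hu
    rw [hceil]
    omega
  · have hq0 : q ≠ 0 := by
      rintro rfl
      push_cast at *
      omega
    obtain ⟨q, rfl⟩ := Nat.exists_eq_succ_of_ne_zero hq0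
    -- The width `m + t` of the core is what remains of `n` after `q - 1` turns of `m + 1` columns
    -- each; `2q < r ≤ m` gives `1 ≤ t ≤ m - 2`.
    have hu := (hasCornerFort_core (m := m) (t := m + 1 - r) (by omega)
      (by push_cast at hrq; omega)).append_turns (by omega) q
    push_cast at *
    rw [show (m : ℤ) + (m + 1 - r) + q * (m + 1) = n by linarith] at hu
    have := zeroBlockingNumber_gridGraph_le hu
    have e : ((q : ℤ) + 1) * m = q * m + m := by ring
    omega
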